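/- Let $p(\cdot):\mathbb R^n\to[1,\infty]$ be a measurable exponent, with $p_-=\operatorname{ess\,inf}p$ and $p_+=\operatorname{ess\,sup}p$, and put $$\varrho_{p(\cdot)}(f)=\int_{\{p<\infty\}}|f(x)|^{p(x)}\,dx+\|f\|_{L^\infty(\{p=\infty\})}.$$ For a constant $q\in[1,\infty]$ and a sequence $f=(f_\nu)_\nu$ of measurable functions on $\mathbb R^n$, let $$\varrho_q(f)=\sum_{\nu}\inf\Big\{\lambda>0:\ \varrho_{p(\cdot)}\big(f_\nu/\lambda^{1/q}\big)\le 1\Big\}\qquad(\lambda^{1/\infty}=1,\ \inf\emptyset=\infty).$$ Let $\ell^q(L^{p(\cdot)})$ be the space of those $f$ (modulo equality almost everywhere) with $\varrho_q(f/\mu)<\infty$ for some $\mu>0$, normed by $\|f\|=\inf\{\mu>0:\varrho_q(f/\mu)\le1\}$. A normed space $X$ is uniformly convex if for every $\varepsilon\in(0,2]$ there is $\delta>0$ such that $\|\tfrac{x+y}2\|\le1-\delta$ whenever $\|x\|=\|y\|=1$ and $\|x-y\|\ge\varepsilon$. Then: 1. If $q\in(1,\infty)$ is constant and $1<p_-\le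 p_+<\infty$, then $\ell^q(L^{p(\cdot)})$ is uniformly convex. 2. $\ell^\infty(L^{p(\cdot)})$ is not uniformly convex. 3. $\ell^1(L^{p(\cdot)})$ is not uniformly convex. -/

import Mathlib

open MeasureTheory Filter
open scoped ENNReal

/-- Variable exponents of the class `𝒫(ℝⁿ)`: measurable functions with values in `[1, ∞]`
(inequalities between exponents are understood almost everywhere). -/
structure VariableExponent (n : ℕ) where
  toFun : EuclideanSpace ℝ (Fin n) → ℝ≥0∞
  measurable_toFun : Measurable toFun
  one_le : ∀ᵐ x, 1 ≤ toFun x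

namespace VariableExponent

/-- `p₋ = ess inf p`. -/
noncomputable def lower {n : ℕ} (p : VariableExponent n) : ℝ≥0∞ := essInf p.toFun volume

/-- `p₊ = ess sup p`. -/
noncomputable def upper {n : ℕ} (p : VariableExponent n) : ℝ≥0∞ := essSup p.toFun volume

end VariableExponent

/-- The modular `∫_{p < ∞} |f(x)|^{p(x)} dx + ‖f‖_{L^∞({p = ∞})}` of `L^{p(·)}(ℝⁿ)`. -/
noncomputable def varModular {𝕜 : Type*} [RCLike 𝕜] {n : ℕ}
    (p : EuclideanSpace ℝ (Fin n) → ℝ≥0∞) (f : EuclideanSpace ℝ (Fin n) → 𝕜) : ℝ≥0∞ :=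
  (∫⁻ x in {x | p x ≠ ∞}, ‖f x‖ₑ ^ (p x).toReal) +
    eLpNormEssSup f (volume.restrict {x | p x = ∞})

/-- The modular of `ℓ^{q(·)}(L^{p(·)})`:
`∑_ν inf {t > 0 : ϱ_{p(·)}(f_ν / t^{1/q(·)}) ≤ 1}`, where `inf ∅ = ∞` and `t^{1/∞} = 1`
(the latter since `(∞⁻¹).toReal = 0`). -/
noncomputable def mixedModular {𝕜 : Type*} [RCLike 𝕜] {n : ℕ}
    (p q : EuclideanSpace ℝ (Fin n) → ℝ≥0∞) (f : ℕ → EuclideanSpace ℝ (Fin n) → 𝕜) : ℝ≥0∞ :=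
  ∑' ν, ⨅ (t : ℝ) (_ : 0 < t)
    (_ : varModular p (fun x => (t ^ ((q x)⁻¹).toReal)⁻¹ • f ν x) ≤ 1), ENNReal.ofReal t

/-- Membership in `ℓ^{q(·)}(L^{p(·)})`: some positive multiple has finite modular.
(This forces every `f_ν` to lie in `L^{p(·)}`.) -/
def MemMixed {𝕜 : Type*} [RCLike 𝕜] {n : ℕ}
    (p q : EuclideanSpace ℝ (Fin n) → ℝ≥0∞) (f : ℕ → EuclideanSpace ℝ (Fin n) → 𝕜) : Prop :=
  ∃ r : ℝ, 0 < r ∧ mixedModular p q (fun ν x => r⁻¹ • f ν x) < ∞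

/-- The Luxemburg functional `inf {r > 0 : ϱ(f / r) ≤ 1}` of `ℓ^{q(·)}(L^{p(·)})`. -/
noncomputable def mixedNorm {𝕜 : Type*} [RCLike 𝕜] {n : ℕ}
    (p q : EuclideanSpace ℝ (Fin n) → ℝ≥0∞) (f : ℕ → EuclideanSpace ℝ (Fin n) → 𝕜) : ℝ :=
  sInf {r : ℝ | 0 < r ∧ mixedModular p q (fun ν x => r⁻¹ • f ν x) ≤ 1}

/-! ### Facts needed to see that, for constant `q ∈ [1, ∞]`, the functional above is a norm -/

section NormFacts

variable {𝕜 : Type*} [RCLike 𝕜] {n : ℕ}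

theorem varModular_congr_norm {p : EuclideanSpace ℝ (Fin n) → ℝ≥0∞}
    {f g : EuclideanSpace ℝ (Fin n) → 𝕜} (h : ∀ᵐ x, ‖f x‖ = ‖g x‖) :
    varModular p f = varModular p g := by
  have h' : ∀ᵐ x, ‖f x‖ₑ = ‖g x‖ₑ := by
    filter_upwards [h] with x hx
    rw [← ofReal_norm, ← ofReal_norm, hx]
  unfold varModular
  congr 1
  · apply lintegral_congr_ae
    filter_upwards [ae_restrict_of_ae h'] with x hx
    rw [hx]
  · unfold eLpNormEssSup
    apply essSup_congr_ae
    exact ae_restrict_of_ae h'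

theorem mixedModular_congr_norm {p q : EuclideanSpace ℝ (Fin n) → ℝ≥0∞}
    {f g : ℕ → EuclideanSpace ℝ (Fin n) → 𝕜} (h : ∀ ν, ∀ᵐ x, ‖f ν x‖ = ‖g ν x‖) :
    mixedModular p q f = mixedModular p q g := by
  unfold mixedModular
  congr 1
  funext ν
  have key : ∀ t : ℝ, varModular p (fun x => (t ^ ((q x)⁻¹).toReal)⁻¹ • f ν x) =
      varModular p (fun x => (t ^ ((q x)⁻¹).toReal)⁻¹ • g ν x) := by
    intro t
    apply varModular_congr_norm
    filter_upwards [h ν] with x hx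
    rw [norm_smul, norm_smul, hx]
  simp only [key]

theorem varModular_zero (p : VariableExponent n) :
    varModular p.toFun (fun _ => (0 : 𝕜)) = 0 := by
  unfold varModular
  have h1 : (∫⁻ x in {x | p.toFun x ≠ ∞}, ‖(0 : 𝕜)‖ₑ ^ (p.toFun x).toReal) = 0 := by
    have hm : MeasurableSet {x | p.toFun x ≠ ∞} :=
      p.measurable_toFun (measurableSet_singleton ∞).compl
    rw [setLIntegral_congr_fun_ae (g := fun _ => 0) hm]
    · simp
    · filter_upwards [p.one_le] with x hx hx'
      have : 0 < (p.toFun x).toReal := ENNReal.toReal_pos (by positivity) hx'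
      simp [this]
  rw [h1]
  rw [zero_add, eLpNormEssSup_eq_zero_iff]
  exact EventuallyEq.rfl

theorem varModular_convex (p : VariableExponent n) {f g : EuclideanSpace ℝ (Fin n) → 𝕜}
    (hf : AEStronglyMeasurable f) {a b : ℝ}
    (ha : 0 ≤ a) (hb : 0 ≤ b) (hab : a + b ≤ 1) :
    varModular p.toFun (fun x => a • f x + b • g x) ≤
      ENNReal.ofReal a * varModular p.toFun f + ENNReal.ofReal b * varModular p.toFun g := by
  have hm : MeasurableSet {x | p.toFun x ≠ ∞} :=
    p.measurable_toFun (measurableSet_singleton ∞).compl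
  have h1 : (∫⁻ x in {x | p.toFun x ≠ ∞}, ‖a • f x + b • g x‖ₑ ^ (p.toFun x).toReal) ≤
      ENNReal.ofReal a * (∫⁻ x in {x | p.toFun x ≠ ∞}, ‖f x‖ₑ ^ (p.toFun x).toReal) +
      ENNReal.ofReal b * (∫⁻ x in {x | p.toFun x ≠ ∞}, ‖g x‖ₑ ^ (p.toFun x).toReal) := by
    rw [← lintegral_const_mul' _ _ ENNReal.ofReal_ne_top,
      ← lintegral_const_mul' _ _ ENNReal.ofReal_ne_top, ← lintegral_add_left']
    · apply setLIntegral_mono_ae' hm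
      filter_upwards [p.one_le] with x hx hx'
      have h1 : 1 ≤ (p.toFun x).toReal := by
        simpa using ENNReal.toReal_mono hx' hx
      have h0 : 0 < (p.toFun x).toReal := by linarith
      have hle : ‖a • f x + b • g x‖ₑ ≤
          ENNReal.ofReal a * ‖f x‖ₑ + ENNReal.ofReal b * ‖g x‖ₑ := by
        refine (enorm_add_le _ _).trans ?_
        rw [enorm_smul, enorm_smul, Real.enorm_of_nonneg ha, Real.enorm_of_nonneg hb]
      refine (ENNReal.rpow_le_rpow hle h0.le).trans ?_
      have hJ := ENNReal.rpow_arith_mean_le_arith_mean_rpow (Finset.univ : Finset (Fin 3))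
        ![ENNReal.ofReal a, ENNReal.ofReal b, ENNReal.ofReal (1 - a - b)]
        ![‖f x‖ₑ, ‖g x‖ₑ, 0]
        (by
          simp only [Fin.sum_univ_three, Matrix.cons_val_zero, Matrix.cons_val_one,
            Matrix.cons_val]
          rw [← ENNReal.ofReal_add ha hb, ← ENNReal.ofReal_add (by linarith) (by linarith)]
          simp) h1
      simpa [Fin.sum_univ_three, h0] using hJ
    · apply AEMeasurable.const_mul
      exact (hf.enorm.restrict).pow (p.measurable_toFun.ennreal_toReal.aemeasurable)
  have h2 : eLpNormEssSup (fun x => a • f x + b • g x) (volume.restrict {x | p.toFun x = ∞}) ≤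
      ENNReal.ofReal a * eLpNormEssSup f (volume.restrict {x | p.toFun x = ∞}) +
      ENNReal.ofReal b * eLpNormEssSup g (volume.restrict {x | p.toFun x = ∞}) := by
    refine (eLpNormEssSup_add_le (f := fun x => a • f x) (g := fun x => b • g x)).trans ?_
    have e1 := eLpNormEssSup_const_smul_le (c := a) (f := f)
      (μ := volume.restrict {x | p.toFun x = ∞})
    have e2 := eLpNormEssSup_const_smul_le (c := b) (f := g)
      (μ := volume.restrict {x | p.toFun x = ∞})
    rw [Real.enorm_of_nonneg ha] at e1
    rw [Real.enorm_of_nonneg hb] at e2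
    exact add_le_add e1 e2
  unfold varModular
  refine (add_le_add h1 h2).trans (le_of_eq ?_)
  ring

theorem ae_eq_zero_of_varModular (p : VariableExponent n) {f : EuclideanSpace ℝ (Fin n) → 𝕜}
    (hf : AEStronglyMeasurable f) (h : varModular p.toFun f = 0) : ∀ᵐ x, f x = 0 := by
  have hm : MeasurableSet {x | p.toFun x ≠ ∞} :=
    p.measurable_toFun (measurableSet_singleton ∞).compl
  have hm' : MeasurableSet {x | p.toFun x = ∞} :=
    p.measurable_toFun (measurableSet_singleton ∞)
  unfold varModular at h
  obtain ⟨h1, h2⟩ := add_eq_zero.1 h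
  rw [lintegral_eq_zero_iff' ((hf.enorm.restrict).pow
    (p.measurable_toFun.ennreal_toReal.aemeasurable)), EventuallyEq, ae_restrict_iff' hm] at h1
  rw [eLpNormEssSup_eq_zero_iff, EventuallyEq, ae_restrict_iff' hm'] at h2
  filter_upwards [h1, h2, p.one_le] with x hx1 hx2 hx3
  by_cases hx : p.toFun x = ∞
  · simpa using hx2 hx
  · have h0 : 0 < (p.toFun x).toReal := ENNReal.toReal_pos (by positivity) hx
    have := hx1 hx
    simp only [Pi.zero_apply, ENNReal.rpow_eq_zero_iff_of_pos h0] at this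
    simpa using this

theorem mixedModular_convex (p : VariableExponent n) (q : ℝ≥0∞) (hq : 1 ≤ q)
    {f g : ℕ → EuclideanSpace ℝ (Fin n) → 𝕜}
    (hf : ∀ ν, AEStronglyMeasurable (f ν)) {a b : ℝ}
    (ha : 0 < a) (hb : 0 < b) (hab : a + b = 1) :
    mixedModular p.toFun (fun _ => q) (fun ν x => a • f ν x + b • g ν x) ≤
      ENNReal.ofReal a * mixedModular p.toFun (fun _ => q) f +
        ENNReal.ofReal b * mixedModular p.toFun (fun _ => q) g := by
  unfold mixedModular
  rw [← ENNReal.tsum_mul_left, ← ENNReal.tsum_mul_left, ← ENNReal.tsum_add]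
  refine ENNReal.tsum_le_tsum fun ν => ?_
  set s : ℝ := (q⁻¹).toReal with hs
  have hs0 : 0 ≤ s := ENNReal.toReal_nonneg
  have hs1 : s ≤ 1 := by
    have : q⁻¹ ≤ 1 := ENNReal.inv_le_one.2 hq
    have h := ENNReal.toReal_mono ENNReal.one_ne_top this
    rwa [ENNReal.toReal_one] at h
  have ha' : ENNReal.ofReal a ≠ 0 := by simpa using ha
  have hb' : ENNReal.ofReal b ≠ 0 := by simpa using hb
  simp only [ENNReal.mul_iInf_of_ne ha' ENNReal.ofReal_ne_top,
    ENNReal.mul_iInf_of_ne hb' ENNReal.ofReal_ne_top, ENNReal.iInf_add, ENNReal.add_iInf,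
    le_iInf_iff]
  intro u hu hgu t ht hft
  have hT : 0 < a * t + b * u := by positivity
  have hTs : 0 < (a * t + b * u) ^ s := Real.rpow_pos_of_pos hT s
  have hts : 0 < t ^ s := Real.rpow_pos_of_pos ht s
  have hus : 0 < u ^ s := Real.rpow_pos_of_pos hu s
  have hconc : a * t ^ s + b * u ^ s ≤ (a * t + b * u) ^ s := by
    have := (Real.concaveOn_rpow hs0 hs1).2 (x := t) (y := u) ht.le hu.le ha.le hb.le hab
    simpa using this
  have hw : a * t ^ s / (a * t + b * u) ^ s + b * u ^ s / (a * t + b * u) ^ s ≤ 1 := by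
    rw [← add_div]
    exact (div_le_one hTs).2 hconc
  have hadm : varModular p.toFun
      (fun x => ((a * t + b * u) ^ s)⁻¹ • (a • f ν x + b • g ν x)) ≤ 1 := by
    have hc := varModular_convex p (f := fun x => (t ^ s)⁻¹ • f ν x)
      (g := fun x => (u ^ s)⁻¹ • g ν x) ((hf ν).const_smul _)
      (a := a * t ^ s / (a * t + b * u) ^ s) (b := b * u ^ s / (a * t + b * u) ^ s)
      (by positivity) (by positivity) hw
    have he : (fun x => ((a * t + b * u) ^ s)⁻¹ • (a • f ν x + b • g ν x)) =
        fun x => (a * t ^ s / (a * t + b * u) ^ s) • (t ^ s)⁻¹ • f ν x +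
          (b * u ^ s / (a * t + b * u) ^ s) • (u ^ s)⁻¹ • g ν x := by
      funext x
      rw [smul_add, smul_smul, smul_smul, smul_smul, smul_smul]
      congr 2 <;> field_simp
    rw [he]
    refine hc.trans ?_
    calc _ ≤ ENNReal.ofReal (a * t ^ s / (a * t + b * u) ^ s) * 1 +
          ENNReal.ofReal (b * u ^ s / (a * t + b * u) ^ s) * 1 := by gcongr
      _ ≤ 1 := by
        rw [mul_one, mul_one, ← ENNReal.ofReal_add (by positivity) (by positivity)]
        exact ENNReal.ofReal_le_one.2 hw
  refine (iInf_le_of_le (a * t + b * u) (iInf_le_of_le hT (iInf_le_of_le hadm le_rfl))).trans ?_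
  rw [ENNReal.ofReal_add (by positivity) (by positivity), ENNReal.ofReal_mul ha.le,
    ENNReal.ofReal_mul hb.le]

theorem mixedModular_zero (p : VariableExponent n) (q : EuclideanSpace ℝ (Fin n) → ℝ≥0∞) :
    mixedModular p.toFun q (fun _ _ => (0 : 𝕜)) = 0 := by
  unfold mixedModular
  rw [ENNReal.tsum_eq_zero]
  intro ν
  refine le_antisymm (ENNReal.le_of_forall_pos_le_add fun ε hε _ => ?_) zero_le
  refine iInf_le_of_le (ε : ℝ) (iInf_le_of_le (by exact_mod_cast hε) (iInf_le_of_le ?_ ?_))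
  · simp only [smul_zero]
    rw [varModular_zero]
    exact zero_le_one
  · simp

/-- An element of the space has a positive multiple of modular at most one. -/
theorem MemMixed.exists_le_one {p : VariableExponent n} {q : ℝ≥0∞} (hq : 1 ≤ q)
    {f : ℕ → EuclideanSpace ℝ (Fin n) → 𝕜} (hm : ∀ ν, AEStronglyMeasurable (f ν))
    (hf : MemMixed p.toFun (fun _ => q) f) :
    ∃ r : ℝ, 0 < r ∧ mixedModular p.toFun (fun _ => q) (fun ν x => r⁻¹ • f ν x) ≤ 1 := by
  obtain ⟨r, hr, hM⟩ := hf
  set M := mixedModular p.toFun (fun _ => q) (fun ν x => r⁻¹ • f ν x) with hMdef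
  have hM0 : 0 ≤ M.toReal := ENNReal.toReal_nonneg
  set c : ℝ := M.toReal + 2 with hc
  have hc2 : 2 ≤ c := by linarith
  have hc0 : 0 < c := by linarith
  refine ⟨c * r, by positivity, ?_⟩
  have h := mixedModular_convex p q hq (f := fun ν x => r⁻¹ • f ν x)
    (g := fun _ _ => (0 : 𝕜)) (fun ν => (hm ν).const_smul _) (a := c⁻¹) (b := 1 - c⁻¹)
    (by positivity) (by
      have : c⁻¹ < 1 := inv_lt_one_of_one_lt₀ (by linarith)
      linarith) (by ring)
  rw [mixedModular_zero, ← hMdef, mul_zero, add_zero] at h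
  have he : (fun ν x => (c * r)⁻¹ • f ν x) =
      fun ν x => c⁻¹ • r⁻¹ • f ν x + (1 - c⁻¹) • (0 : 𝕜) := by
    funext ν x
    rw [smul_zero, add_zero, smul_smul, mul_inv]
  rw [he]
  refine h.trans ?_
  rw [← ENNReal.ofReal_toReal hM.ne, ← ENNReal.ofReal_mul (by positivity)]
  apply ENNReal.ofReal_le_one.2
  rw [inv_mul_le_iff₀ hc0]
  linarith

theorem mixedModular_add_le_one {p : VariableExponent n} {q : ℝ≥0∞} (hq : 1 ≤ q)
    {f g : ℕ → EuclideanSpace ℝ (Fin n) → 𝕜} (hm : ∀ ν, AEStronglyMeasurable (f ν))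
    {r s : ℝ} (hr : 0 < r) (hs : 0 < s)
    (hf : mixedModular p.toFun (fun _ => q) (fun ν x => r⁻¹ • f ν x) ≤ 1)
    (hg : mixedModular p.toFun (fun _ => q) (fun ν x => s⁻¹ • g ν x) ≤ 1) :
    mixedModular p.toFun (fun _ => q) (fun ν x => (r + s)⁻¹ • (f ν x + g ν x)) ≤ 1 := by
  have hab : r / (r + s) + s / (r + s) = 1 := by field_simp
  have h := mixedModular_convex p q hq (f := fun ν x => r⁻¹ • f ν x)
    (g := fun ν x => s⁻¹ • g ν x) (fun ν => (hm ν).const_smul _) (a := r / (r + s))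
    (b := s / (r + s)) (by positivity) (by positivity) hab
  have he : (fun ν x => (r + s)⁻¹ • (f ν x + g ν x)) =
      fun ν x => (r / (r + s)) • r⁻¹ • f ν x + (s / (r + s)) • s⁻¹ • g ν x := by
    funext ν x
    rw [smul_add, smul_smul, smul_smul]
    congr 2 <;> field_simp
  rw [he]
  refine h.trans ?_
  calc _ ≤ ENNReal.ofReal (r / (r + s)) * 1 + ENNReal.ofReal (s / (r + s)) * 1 := by gcongr
    _ = 1 := by
      rw [mul_one, mul_one, ← ENNReal.ofReal_add (by positivity) (by positivity), hab,
        ENNReal.ofReal_one]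

theorem mixedModular_smul_smul {p q : EuclideanSpace ℝ (Fin n) → ℝ≥0∞}
    (f : ℕ → EuclideanSpace ℝ (Fin n) → 𝕜) {c : 𝕜} (r : ℝ) :
    mixedModular p q (fun ν x => r⁻¹ • c • f ν x) =
      mixedModular p q (fun ν x => (r / ‖c‖)⁻¹ • f ν x) := by
  apply mixedModular_congr_norm
  intro ν
  refine ae_of_all _ fun x => ?_
  simp only [norm_smul, norm_inv, norm_div, Real.norm_eq_abs, abs_norm]
  rw [inv_div, div_eq_mul_inv]
  ring

theorem mixedNorm_nonneg {p q : EuclideanSpace ℝ (Fin n) → ℝ≥0∞}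
    (f : ℕ → EuclideanSpace ℝ (Fin n) → 𝕜) : 0 ≤ mixedNorm p q f :=
  Real.sInf_nonneg fun _ hr => hr.1.le

theorem mixedNorm_congr_norm {p q : EuclideanSpace ℝ (Fin n) → ℝ≥0∞}
    {f g : ℕ → EuclideanSpace ℝ (Fin n) → 𝕜} (h : ∀ ν, ∀ᵐ x, ‖f ν x‖ = ‖g ν x‖) :
    mixedNorm p q f = mixedNorm p q g := by
  have key : ∀ r : ℝ, mixedModular p q (fun ν x => r⁻¹ • f ν x) =
      mixedModular p q (fun ν x => r⁻¹ • g ν x) := by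
    intro r
    apply mixedModular_congr_norm
    intro ν
    filter_upwards [h ν] with x hx
    rw [norm_smul, norm_smul, hx]
  unfold mixedNorm
  simp only [key]

theorem mixedNorm_zero (p : VariableExponent n) (q : EuclideanSpace ℝ (Fin n) → ℝ≥0∞) :
    mixedNorm p.toFun q (fun _ _ => (0 : 𝕜)) = 0 := by
  refine le_antisymm (le_of_forall_pos_le_add fun ε hε => ?_) (mixedNorm_nonneg _)
  rw [zero_add]
  refine csInf_le ⟨0, fun r hr => hr.1.le⟩ ⟨hε, ?_⟩
  simp only [smul_zero]
  rw [mixedModular_zero]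
  exact zero_le_one

theorem mixedNorm_smul (p : VariableExponent n) (q : EuclideanSpace ℝ (Fin n) → ℝ≥0∞)
    (c : 𝕜) (f : ℕ → EuclideanSpace ℝ (Fin n) → 𝕜) :
    mixedNorm p.toFun q (fun ν x => c • f ν x) = ‖c‖ * mixedNorm p.toFun q f := by
  rcases eq_or_ne c 0 with rfl | hc
  · simp only [zero_smul, norm_zero, zero_mul]
    exact mixedNorm_zero p q
  have hc' : 0 < ‖c‖ := norm_pos_iff.2 hc
  unfold mixedNorm
  rw [← smul_eq_mul, ← Real.sInf_smul_of_nonneg hc'.le]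
  congr 1
  ext r
  rw [Set.mem_smul_set_iff_inv_smul_mem₀ hc'.ne']
  have h1 := mixedModular_smul_smul (p := p.toFun) (q := q) f (c := c) r
  rw [div_eq_inv_mul] at h1
  have h2 : 0 < ‖c‖⁻¹ * r ↔ 0 < r := mul_pos_iff_of_pos_left (inv_pos.2 hc')
  exact and_congr h2.symm (by rw [h1]; rfl)

theorem mixedNorm_add_le {p : VariableExponent n} {q : ℝ≥0∞} (hq : 1 ≤ q)
    {f g : ℕ → EuclideanSpace ℝ (Fin n) → 𝕜} (hmf : ∀ ν, AEStronglyMeasurable (f ν))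
    (hmg : ∀ ν, AEStronglyMeasurable (g ν))
    (hf : MemMixed p.toFun (fun _ => q) f) (hg : MemMixed p.toFun (fun _ => q) g) :
    mixedNorm p.toFun (fun _ => q) (fun ν x => f ν x + g ν x) ≤
      mixedNorm p.toFun (fun _ => q) f + mixedNorm p.toFun (fun _ => q) g := by
  obtain ⟨r₀, hr₀⟩ := hf.exists_le_one hq hmf
  obtain ⟨s₀, hs₀⟩ := hg.exists_le_one hq hmg
  refine le_of_forall_pos_le_add fun ε hε => ?_
  obtain ⟨r, hr, hrε⟩ := Real.lt_sInf_add_pos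
    (s := {r : ℝ | 0 < r ∧ mixedModular p.toFun (fun _ => q) (fun ν x => r⁻¹ • f ν x) ≤ 1})
    ⟨r₀, hr₀⟩ (half_pos hε)
  obtain ⟨s, hs, hsε⟩ := Real.lt_sInf_add_pos
    (s := {r : ℝ | 0 < r ∧ mixedModular p.toFun (fun _ => q) (fun ν x => r⁻¹ • g ν x) ≤ 1})
    ⟨s₀, hs₀⟩ (half_pos hε)
  have hrs : mixedNorm p.toFun (fun _ => q) (fun ν x => f ν x + g ν x) ≤ r + s :=
    csInf_le ⟨0, fun r hr => hr.1.le⟩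
      ⟨add_pos hr.1 hs.1, mixedModular_add_le_one hq hmf hr.1 hs.1 hr.2 hs.2⟩
  unfold mixedNorm at hrs ⊢
  linarith

theorem ae_eq_zero_of_mixedNorm {p : VariableExponent n} {q : ℝ≥0∞} (hq : 1 ≤ q)
    {f : ℕ → EuclideanSpace ℝ (Fin n) → 𝕜} (hm : ∀ ν, AEStronglyMeasurable (f ν))
    (hf : MemMixed p.toFun (fun _ => q) f) (h : mixedNorm p.toFun (fun _ => q) f = 0) (ν : ℕ) :
    ∀ᵐ x, f ν x = 0 := by
  apply ae_eq_zero_of_varModular p (hm ν)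
  set s : ℝ := (q⁻¹).toReal with hs
  have hs0 : 0 ≤ s := ENNReal.toReal_nonneg
  have hs1 : s ≤ 1 := by
    have : q⁻¹ ≤ 1 := ENNReal.inv_le_one.2 hq
    have h := ENNReal.toReal_mono ENNReal.one_ne_top this
    rwa [ENNReal.toReal_one] at h
  refine le_antisymm (ENNReal.le_of_forall_pos_le_add fun ε hε _ => ?_) zero_le
  rw [zero_add]
  set δ : ℝ := min ε 1 with hδ
  have hδ0 : 0 < δ := lt_min (by exact_mod_cast hε) one_pos
  obtain ⟨r₀, hr₀⟩ := hf.exists_le_one hq hm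
  obtain ⟨r, hr, hrδ⟩ := Real.lt_sInf_add_pos
    (s := {r : ℝ | 0 < r ∧ mixedModular p.toFun (fun _ => q) (fun ν x => r⁻¹ • f ν x) ≤ 1})
    ⟨r₀, hr₀⟩ (half_pos hδ0)
  unfold mixedNorm at h
  rw [h, zero_add] at hrδ
  have hlt : (⨅ (t : ℝ) (_ : 0 < t)
      (_ : varModular p.toFun (fun x => (t ^ s)⁻¹ • r⁻¹ • f ν x) ≤ 1), ENNReal.ofReal t) < 2 :=
    lt_of_le_of_lt ((ENNReal.le_tsum (f := fun ν => ⨅ (t : ℝ) (_ : 0 < t)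
      (_ : varModular p.toFun (fun x => (t ^ s)⁻¹ • r⁻¹ • f ν x) ≤ 1), ENNReal.ofReal t) ν).trans
      hr.2) (by norm_num)
  simp only [iInf_lt_iff] at hlt
  obtain ⟨t, ht, hft, ht2⟩ := hlt
  have ht2' : t < 2 := by
    have := (ENNReal.ofReal_lt_iff_lt_toReal ht.le (by norm_num)).1 ht2
    simpa using this
  have hts : 0 < t ^ s := Real.rpow_pos_of_pos ht s
  have hts2 : t ^ s ≤ 2 := by
    calc t ^ s ≤ 2 ^ s := Real.rpow_le_rpow ht.le ht2'.le hs0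
      _ ≤ 2 ^ (1 : ℝ) := Real.rpow_le_rpow_of_exponent_le (by norm_num) hs1
      _ = 2 := by norm_num
  have hκ : r * t ^ s ≤ δ := by
    nlinarith [hr.1]
  have hc := varModular_convex p (f := fun x => (t ^ s)⁻¹ • r⁻¹ • f ν x)
    (g := fun _ => (0 : 𝕜)) (((hm ν).const_smul _).const_smul _) (a := r * t ^ s) (b := 0)
    (mul_nonneg hr.1.le hts.le) le_rfl
    (by rw [add_zero]; exact hκ.trans (min_le_right _ _))
  have he : (fun x => (r * t ^ s) • (t ^ s)⁻¹ • r⁻¹ • f ν x + (0 : ℝ) • (0 : 𝕜)) = f ν := by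
    funext x
    have hr0 := hr.1.ne'
    rw [smul_zero, add_zero, smul_smul, smul_smul]
    have : r * t ^ s * ((t ^ s)⁻¹ * r⁻¹) = 1 := by field_simp
    rw [← mul_assoc] at this
    rw [this, one_smul]
  rw [he] at hc
  refine hc.trans ?_
  calc _ ≤ ENNReal.ofReal (r * t ^ s) * 1 + ENNReal.ofReal 0 * _ := by gcongr
    _ = ENNReal.ofReal (r * t ^ s) := by simp
    _ ≤ ENNReal.ofReal ε := ENNReal.ofReal_le_ofReal (hκ.trans (min_le_left _ _))
    _ = ε := by simp

end NormFacts

/-! ### The space `ℓ^q(L^{p(·)})` for constant `q ∈ [1, ∞]` -/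

/-- The linear space `ℓ^q(L^{p(·)}(ℝⁿ))`: sequences of (classes, modulo equality almost
everywhere, of) measurable functions for which some positive multiple has finite modular. -/
noncomputable def mixedSubmodule (𝕜 : Type*) [RCLike 𝕜] {n : ℕ} (p : VariableExponent n)
    (q : ℝ≥0∞) [hq : Fact (1 ≤ q)] :
    Submodule 𝕜 (ℕ → (EuclideanSpace ℝ (Fin n) →ₘ[volume] 𝕜)) where
  carrier := {f | MemMixed p.toFun (fun _ => q) fun ν => ⇑(f ν)}
  zero_mem' := by
    refine ⟨1, one_pos, ?_⟩
    have h : mixedModular p.toFun (fun _ => q) (fun ν x => (1 : ℝ)⁻¹ •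
        ((0 : ℕ → (EuclideanSpace ℝ (Fin n) →ₘ[volume] 𝕜)) ν) x) =
        mixedModular p.toFun (fun _ => q) (fun _ _ => (0 : 𝕜)) := by
      apply mixedModular_congr_norm
      intro ν
      filter_upwards [AEEqFun.coeFn_zero (α := EuclideanSpace ℝ (Fin n)) (μ := volume) (β := 𝕜)]
        with x hx
      simp [hx]
    rw [h, mixedModular_zero]
    exact ENNReal.zero_lt_top
  add_mem' := by
    intro f g hf hg
    obtain ⟨r, hr, hfr⟩ := MemMixed.exists_le_one hq.out (fun ν => (f ν).aestronglyMeasurable) hf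
    obtain ⟨s, hs, hgs⟩ := MemMixed.exists_le_one hq.out (fun ν => (g ν).aestronglyMeasurable) hg
    refine ⟨r + s, add_pos hr hs, ?_⟩
    have h := mixedModular_add_le_one hq.out (fun ν => (f ν).aestronglyMeasurable) hr hs hfr hgs
    rw [mixedModular_congr_norm (g := fun ν x => (r + s)⁻¹ • (f ν x + g ν x))]
    · exact h.trans_lt ENNReal.one_lt_top
    · intro ν
      filter_upwards [AEEqFun.coeFn_add (f ν) (g ν)] with x hx
      simp [hx]
  smul_mem' := by
    rintro c f ⟨r, hr, hfr⟩
    have he : ∀ s : ℝ, mixedModular p.toFun (fun _ => q) (fun ν x => s⁻¹ • ((c • f) ν) x) =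
        mixedModular p.toFun (fun _ => q) (fun ν x => s⁻¹ • c • f ν x) := by
      intro s
      apply mixedModular_congr_norm
      intro ν
      filter_upwards [AEEqFun.coeFn_smul c (f ν)] with x hx
      simp [hx]
    rcases eq_or_ne c 0 with rfl | hc
    · refine ⟨1, one_pos, ?_⟩
      rw [he]
      simp only [zero_smul, smul_zero]
      rw [mixedModular_zero]
      exact ENNReal.zero_lt_top
    · have hc' : 0 < ‖c‖ := norm_pos_iff.2 hc
      refine ⟨r * ‖c‖, by positivity, ?_⟩
      rw [he, mixedModular_smul_smul, mul_div_cancel_right₀ _ hc'.ne']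
      exact hfr

/-- The space `ℓ^q(L^{p(·)}(ℝⁿ))` with its Luxemburg norm. -/
def MixedSpace (𝕜 : Type*) [RCLike 𝕜] {n : ℕ} (p : VariableExponent n)
    (q : ℝ≥0∞) [Fact (1 ≤ q)] : Type _ :=
  mixedSubmodule 𝕜 p q

section Instances

variable {𝕜 : Type*} [RCLike 𝕜] {n : ℕ} (p : VariableExponent n) (q : ℝ≥0∞) [hq : Fact (1 ≤ q)]

noncomputable instance : AddCommGroup (MixedSpace 𝕜 p q) :=
  inferInstanceAs (AddCommGroup (mixedSubmodule 𝕜 p q))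

noncomputable instance : Module 𝕜 (MixedSpace 𝕜 p q) :=
  inferInstanceAs (Module 𝕜 (mixedSubmodule 𝕜 p q))

noncomputable instance : Norm (MixedSpace 𝕜 p q) where
  norm f := mixedNorm p.toFun (fun _ => q) fun ν => ⇑(f.1 ν)

theorem MixedSpace.normCore : NormedSpace.Core 𝕜 (MixedSpace 𝕜 p q) where
  norm_nonneg f := mixedNorm_nonneg _
  norm_smul c f := by
    refine Eq.trans ?_ (mixedNorm_smul p (fun _ => q) c fun ν => ⇑(f.1 ν))
    apply mixedNorm_congr_norm
    intro ν
    filter_upwards [AEEqFun.coeFn_smul c (f.1 ν)] with x hx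
    exact congrArg norm hx
  norm_triangle f g := by
    refine le_trans (le_of_eq ?_) (mixedNorm_add_le hq.out
      (fun ν => (f.1 ν).aestronglyMeasurable) (fun ν => (g.1 ν).aestronglyMeasurable) f.2 g.2)
    apply mixedNorm_congr_norm
    intro ν
    filter_upwards [AEEqFun.coeFn_add (f.1 ν) (g.1 ν)] with x hx
    exact congrArg norm hx
  norm_eq_zero_iff f := by
    constructor
    · intro h
      apply Subtype.ext
      funext ν
      apply AEEqFun.ext
      filter_upwards [ae_eq_zero_of_mixedNorm hq.out
        (fun ν => (f.1 ν).aestronglyMeasurable) f.2 h ν,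
        AEEqFun.coeFn_zero (α := EuclideanSpace ℝ (Fin n)) (μ := volume) (β := 𝕜)] with x hx hx0
      rw [hx]
      exact hx0.symm
    · rintro rfl
      refine Eq.trans ?_ (mixedNorm_zero (𝕜 := 𝕜) p fun _ => q)
      apply mixedNorm_congr_norm
      intro ν
      filter_upwards [AEEqFun.coeFn_zero (α := EuclideanSpace ℝ (Fin n)) (μ := volume) (β := 𝕜)]
        with x hx
      exact congrArg norm hx

noncomputable instance : NormedAddCommGroup (MixedSpace 𝕜 p q) :=
  NormedAddCommGroup.ofCore (MixedSpace.normCore p q)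

noncomputable instance : NormedSpace 𝕜 (MixedSpace 𝕜 p q) :=
  NormedSpace.ofCore (MixedSpace.normCore p q)

end Instances

/-!
Uniform convexity is carried by modulars rather than norms. Call `C > 0` a convexity gap of `ρ` at
precision `ε` if `ρ(x - y) + C ρ((x + y)/2) ≤ (ε + C/2) (ρ x + ρ y)` for all `x, y`. For a
uniformly convex norm `N`, the powers `N ^ p` with `p` in a compact subinterval of `(1, ∞)` share
such a gap at every precision, and the inequality is additive, so it passes to sums and integrals
with the same constants even when the exponent varies with the point. A modular with gaps at all
precisions is uniformly convex, and if it grows at most like a power along rays, then so is its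
Luxemburg norm.

This applies twice: to `∫ |f|^p(x)`, starting from the absolute value of `𝕜`, and then to
`∑ ‖f_ν‖^q`, starting from the norm of `L^{p(·)}` just obtained; for `q < ∞` the latter sum is the
modular of `ℓ^q(L^{p(·)})`.

For `q = 1` the norm is `∑ ‖f_ν‖` and for `q = ∞` it is `sup ‖f_ν‖`. With `‖F‖ = 1`, the pairs
`(F, 0), (0, F)` and `(F, F), (F, -F)` are then unit vectors whose sum and difference both have norm
`2`.
-/

open scoped NNReal

section ScalarConvexityGap

theorem min_midpoint_rpow_lt {p s t : ℝ} (hp : 1 < p) (hs : s ∈ Set.Icc 0 1)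
    (ht : t ∈ Set.Ico 0 1) : min ((1 + s) / 2) t ^ p < (1 + s ^ p) / 2 := by
  have hmin : 0 ≤ min ((1 + s) / 2) t := le_min (by linarith [hs.1]) ht.1
  rcases hs.2.lt_or_eq with hs1 | rfl
  · calc min ((1 + s) / 2) t ^ p
        ≤ (1 / 2 * 1 + 1 / 2 * s) ^ p := by
          gcongr
          exact (min_le_left _ _).trans_eq (by ring)
      _ < 1 / 2 * 1 ^ p + 1 / 2 * s ^ p :=
          (strictConvexOn_rpow hp).2 (Set.mem_Ici.2 zero_le_one) (Set.mem_Ici.2 hs.1)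
            hs1.ne' one_half_pos one_half_pos (add_halves 1)
      _ = (1 + s ^ p) / 2 := by rw [Real.one_rpow]; ring
  · calc min ((1 + 1) / 2) t ^ p < 1 :=
          Real.rpow_lt_one hmin ((min_le_right _ _).trans_lt ht.2) (by linarith)
      _ = (1 + 1 ^ p) / 2 := by rw [Real.one_rpow]; ring

theorem exists_forall_add_min_midpoint_rpow_le {p₁ t : ℝ} (p₂ : ℝ) (hp₁ : 1 < p₁)
    (ht : t ∈ Set.Ico 0 1) :
    ∃ c > 0, ∀ p ∈ Set.Icc p₁ p₂, ∀ s ∈ Set.Icc (0 : ℝ) 1,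
      c + min ((1 + s) / 2) t ^ p ≤ (1 + s ^ p) / 2 := by
  have hpos : ∀ z ∈ Set.Icc p₁ p₂ ×ˢ Set.Icc (0 : ℝ) 1, 0 < z.1 := fun z hz => by
    linarith [hz.1.1]
  have hcont : ContinuousOn
      (fun z : ℝ × ℝ => (1 + z.2 ^ z.1) / 2 - min ((1 + z.2) / 2) t ^ z.1)
      (Set.Icc p₁ p₂ ×ˢ Set.Icc 0 1) := by
    refine (ContinuousOn.div_const (continuousOn_const.add ?_) _).sub ?_
    · exact continuous_snd.continuousOn.rpow continuous_fst.continuousOn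
        fun z hz => Or.inr (hpos z hz)
    · exact ContinuousOn.rpow (Continuous.continuousOn (by fun_prop))
        continuous_fst.continuousOn fun z hz => Or.inr (hpos z hz)
  obtain ⟨c, hc, hgap⟩ := (isCompact_Icc.prod isCompact_Icc).exists_forall_le' hcont
    fun z hz => sub_pos.2 (min_midpoint_rpow_lt (hp₁.trans_le hz.1.1) hz.2 ht)
  exact ⟨c, hc, fun p hp s hs => le_sub_iff_add_le.1 (hgap (p, s) ⟨hp, hs⟩)⟩

theorem exists_forall_mul_rpow_add_min_rpow_le {p₁ : ℝ} (p₂ : ℝ) {t : ℝ≥0} (hp₁ : 1 < p₁)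
    (ht : t < 1) :
    ∃ c : ℝ≥0, 0 < c ∧ ∀ p ∈ Set.Icc p₁ p₂, ∀ a b : ℝ≥0, b ≤ a →
      c * a ^ p + min ((a + b) / 2) (t * a) ^ p ≤ (a ^ p + b ^ p) / 2 := by
  obtain ⟨c, hc, hgap⟩ :=
    exists_forall_add_min_midpoint_rpow_le p₂ hp₁ (t := t) ⟨t.2, NNReal.coe_lt_one.2 ht⟩
  lift c to ℝ≥0 using hc.le
  refine ⟨c, NNReal.coe_pos.1 hc, fun p hp a b hba => ?_⟩
  have hp0 : p ≠ 0 := by linarith [hp.1]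
  rcases eq_or_ne a 0 with rfl | ha
  · obtain rfl : b = 0 := le_antisymm hba zero_le
    simp [hp0]
  have hs : b / a ≤ 1 := div_le_one_of_le₀ hba zero_le
  have hgap' : c + min ((1 + b / a) / 2) t ^ p ≤ (1 + (b / a) ^ p) / 2 := by
    exact_mod_cast hgap p hp ↑(b / a) ⟨NNReal.coe_nonneg _, NNReal.coe_le_one.2 hs⟩
  calc c * a ^ p + min ((a + b) / 2) (t * a) ^ p
      = (c + min ((1 + b / a) / 2) t ^ p) * a ^ p := by
        rw [add_mul, ← NNReal.mul_rpow, min_mul_of_nonneg _ _ zero_le]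
        congr 3
        field_simp
    _ ≤ (1 + (b / a) ^ p) / 2 * a ^ p := by gcongr
    _ = (a ^ p + b ^ p) / 2 := by
        rw [NNReal.div_rpow]
        have : a ^ p ≠ 0 := by simp [ha, hp0]
        field_simp

theorem midpoint_rpow_le {p : ℝ} (hp : 1 ≤ p) (a b : ℝ≥0) :
    ((a + b) / 2) ^ p ≤ (a ^ p + b ^ p) / 2 := by
  have h := NNReal.rpow_arith_mean_le_arith_mean2_rpow 2⁻¹ 2⁻¹ a b (by ext; norm_num) hp
  convert h using 1 <;> ring_nf

/-- Either `d` is small and contributes at most `ε * a ^ p`, or `m` drops below `t * a` and the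
strict convexity of `r ↦ r ^ p` gains a multiple of `a ^ p`, which dominates `d ^ p`. -/
theorem exists_rpow_add_mul_rpow_le {p₁ : ℝ} (p₂ : ℝ) {ε t : ℝ≥0} (hp₁ : 1 < p₁)
    (hε : ε ≤ 1) (ht : t < 1) :
    ∃ C : ℝ≥0, 0 < C ∧ ∀ p ∈ Set.Icc p₁ p₂, ∀ a b m d : ℝ≥0, b ≤ a →
      m ≤ (a + b) / 2 → d ≤ a + b → (ε * a ≤ d → m ≤ t * a) →
      d ^ p + C * m ^ p ≤ (ε + C / 2) * (a ^ p + b ^ p) := by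
  obtain ⟨c, hc, hgap⟩ := exists_forall_mul_rpow_add_min_rpow_le p₂ hp₁ ht
  refine ⟨2 ^ p₂ / c, by positivity, fun p hp a b m d hba hm hd himp => ?_⟩
  have hp1 : 1 ≤ p := hp₁.le.trans hp.1
  have hp0 : 0 ≤ p := by linarith
  rcases lt_or_ge d (ε * a) with hlt | hge
  · have hdp : d ^ p ≤ ε * a ^ p := calc
      d ^ p ≤ (ε * a) ^ p := by gcongr
      _ = ε ^ p * a ^ p := NNReal.mul_rpow
      _ ≤ ε * a ^ p := by
        gcongr
        exact NNReal.rpow_le_self_of_le_one hε hp1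
    have hmp : m ^ p ≤ (a ^ p + b ^ p) / 2 :=
      (NNReal.rpow_le_rpow hm hp0).trans (midpoint_rpow_le hp1 a b)
    calc d ^ p + 2 ^ p₂ / c * m ^ p
        ≤ ε * (a ^ p + b ^ p) + 2 ^ p₂ / c * ((a ^ p + b ^ p) / 2) := by
          gcongr
          exact hdp.trans (by gcongr; exact le_self_add)
      _ = _ := by ring
  · have hdp : d ^ p ≤ 2 ^ p₂ * a ^ p := calc
      d ^ p ≤ (2 * a) ^ p := by
        gcongr
        exact hd.trans ((add_le_add_right hba a).trans_eq (two_mul a).symm)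
      _ = 2 ^ p * a ^ p := NNReal.mul_rpow
      _ ≤ 2 ^ p₂ * a ^ p := by
        gcongr
        · exact one_le_two
        · exact hp.2
    have hmp : m ^ p ≤ min ((a + b) / 2) (t * a) ^ p :=
      NNReal.rpow_le_rpow (le_min hm (himp hge)) hp0
    calc d ^ p + 2 ^ p₂ / c * m ^ p
        ≤ 2 ^ p₂ * a ^ p + 2 ^ p₂ / c * min ((a + b) / 2) (t * a) ^ p := by gcongr
      _ = 2 ^ p₂ / c * (c * a ^ p + min ((a + b) / 2) (t * a) ^ p) := by field_simp
      _ ≤ 2 ^ p₂ / c * ((a ^ p + b ^ p) / 2) := by gcongr; exact hgap p hp a b hba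
      _ = 0 + 2 ^ p₂ / c / 2 * (a ^ p + b ^ p) := by ring
      _ ≤ (ε + 2 ^ p₂ / c / 2) * (a ^ p + b ^ p) := by
        rw [zero_add]
        gcongr
        exact le_add_self

end ScalarConvexityGap

section ExtendedSeminorm

variable {E : Type*} [AddCommGroup E] [Module ℝ≥0 E] {N : E → ℝ≥0∞}

/-- Seminorms that may take the value `∞`. Scalars are restricted to `ℝ≥0`, signs being handled
by `map_neg`. -/
structure IsExtendedSeminorm (N : E → ℝ≥0∞) : Prop where
  add_le (x y : E) : N (x + y) ≤ N x + N y
  map_neg (x : E) : N (-x) = N x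
  map_smul (c : ℝ≥0) (x : E) : N (c • x) = c * N x

/-- Uniform convexity of a functional, tested on its closed unit ball; it is used both for extended
seminorms and for modulars. -/
def IsUniformlyConvex (N : E → ℝ≥0∞) : Prop :=
  ∀ ε : ℝ≥0, 0 < ε → ∃ t : ℝ≥0, t < 1 ∧
    ∀ x y, N x ≤ 1 → N y ≤ 1 → ε ≤ N (x - y) → N ((2⁻¹ : ℝ≥0) • (x + y)) ≤ t

namespace IsExtendedSeminorm

theorem map_zero (hN : IsExtendedSeminorm N) : N 0 = 0 := by
  simpa using hN.map_smul 0 0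

theorem map_sub_comm (hN : IsExtendedSeminorm N) (x y : E) : N (x - y) = N (y - x) := by
  rw [← neg_sub, hN.map_neg]

theorem sub_le (hN : IsExtendedSeminorm N) (x y : E) : N (x - y) ≤ N x + N y := by
  simpa only [sub_eq_add_neg, hN.map_neg] using hN.add_le x (-y)

theorem midpoint_le (hN : IsExtendedSeminorm N) (x y : E) :
    N ((2⁻¹ : ℝ≥0) • (x + y)) ≤ (N x + N y) / 2 := by
  rw [hN.map_smul, ENNReal.coe_inv two_ne_zero, mul_comm, ENNReal.div_eq_inv_mul, mul_comm]
  exact mul_le_mul_right (hN.add_le x y) _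

theorem exists_smul_eq_one (hN : IsExtendedSeminorm N) {x : E}
    (hx₀ : N x ≠ 0) (hx : N x ≠ ∞) : ∃ c : ℝ≥0, N (c • x) = 1 :=
  ⟨(N x).toNNReal⁻¹, by
    rw [hN.map_smul, ENNReal.coe_inv (ENNReal.toNNReal_ne_zero.2 ⟨hx₀, hx⟩),
      ENNReal.coe_toNNReal hx, ENNReal.inv_mul_cancel hx₀ hx]⟩

theorem uniformConvexSpace {X : Type*} [SeminormedAddCommGroup X] (hN : IsExtendedSeminorm N)
    (huc : IsUniformlyConvex N) (φ : X →+ E) (hφ : ∀ x, ‖x‖ₑ = N (φ x)) :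
    UniformConvexSpace X where
  uniform_convex ε hε := by
    obtain ⟨t, ht, hmid⟩ := huc ε.toNNReal (Real.toNNReal_pos.2 hε)
    refine ⟨2 - 2 * t, by simpa using ht, fun x hx y hy hxy => ?_⟩
    have hx' : N (φ x) ≤ 1 := by rw [← hφ, ← ofReal_norm, hx, ENNReal.ofReal_one]
    have hy' : N (φ y) ≤ 1 := by rw [← hφ, ← ofReal_norm, hy, ENNReal.ofReal_one]
    have hxy' : ε.toNNReal ≤ N (φ x - φ y) := by
      rw [← map_sub, ← hφ, ← ofReal_norm]
      exact ENNReal.ofReal_le_ofReal hxy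
    have h := hmid _ _ hx' hy' hxy'
    rw [← _root_.map_add, hN.map_smul, ← hφ] at h
    have h2 : 2⁻¹ * ‖x + y‖ ≤ t := by
      rw [enorm_eq_nnnorm] at h
      exact_mod_cast h
    linarith

end IsExtendedSeminorm

theorem IsUniformlyConvex.exists_midpoint_le (huc : IsUniformlyConvex N)
    (hN : IsExtendedSeminorm N) {ε : ℝ≥0} (hε : 0 < ε) :
    ∃ t : ℝ≥0, t < 1 ∧ ∀ (r : ℝ≥0) (x y : E), N x ≤ r → N y ≤ r → ε * r ≤ N (x - y) →
      N ((2⁻¹ : ℝ≥0) • (x + y)) ≤ t * r := by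
  obtain ⟨t, ht, hball⟩ := huc ε hε
  refine ⟨t, ht, fun r x y hx hy hxy => ?_⟩
  rcases eq_or_ne r 0 with rfl | hr
  · simpa [le_zero_iff.1 hx, le_zero_iff.1 hy] using hN.midpoint_le x y
  have hr0 : (r : ℝ≥0∞) ≠ 0 := ENNReal.coe_ne_zero.2 hr
  have hscale : ∀ z, N (r⁻¹ • z) = N z / r := fun z => by
    rw [hN.map_smul, ENNReal.coe_inv hr, ENNReal.div_eq_inv_mul]
  have h := hball (r⁻¹ • x) (r⁻¹ • y)
  rw [← smul_sub, ← smul_add, smul_comm, hscale, hscale, hscale, hscale,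
    ENNReal.le_div_iff_mul_le (.inl hr0) (.inl ENNReal.coe_ne_top)] at h
  exact (ENNReal.div_le_iff hr0 ENNReal.coe_ne_top).1
    (h (ENNReal.div_le_of_le_mul (by rwa [one_mul])) (ENNReal.div_le_of_le_mul (by rwa [one_mul]))
      hxy)

theorem isExtendedSeminorm_enorm {F : Type*} [SeminormedAddCommGroup F] [NormedSpace ℝ F] :
    IsExtendedSeminorm (fun x : F => ‖x‖ₑ) where
  add_le x y := by
    simp only [enorm_eq_nnnorm]
    exact_mod_cast nnnorm_add_le x y
  map_neg := enorm_neg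
  map_smul c x := by rw [NNReal.smul_def, enorm_smul, NNReal.enorm_eq]

theorem isUniformlyConvex_enorm (F : Type*) [SeminormedAddCommGroup F] [NormedSpace ℝ F]
    [UniformConvexSpace F] : IsUniformlyConvex (fun x : F => ‖x‖ₑ) := by
  intro ε hε
  obtain ⟨δ, hδ, hball⟩ := exists_forall_closed_ball_dist_add_le_two_sub F (NNReal.coe_pos.2 hε)
  refine ⟨(1 - δ / 2).toNNReal, by simpa using hδ, fun x y hx hy hxy => ?_⟩
  have hx' : ‖x‖ ≤ 1 := by simpa [enorm_eq_nnnorm, ← NNReal.coe_le_coe] using hx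
  have hy' : ‖y‖ ≤ 1 := by simpa [enorm_eq_nnnorm, ← NNReal.coe_le_coe] using hy
  have hxy' : ε ≤ ‖x - y‖ := by simpa [enorm_eq_nnnorm, ← NNReal.coe_le_coe] using hxy
  have hmid : ‖(2⁻¹ : ℝ≥0) • (x + y)‖ ≤ 1 - δ / 2 := by
    rw [NNReal.smul_def, norm_smul, NNReal.norm_eq]
    push_cast
    linarith [hball hx' hy' hxy']
  exact (ofReal_norm _).symm.trans_le (ENNReal.ofReal_le_ofReal hmid)

end ExtendedSeminorm

section Luxemburg

variable {E : Type*} [AddCommGroup E] [Module ℝ≥0 E] {ρ : E → ℝ≥0∞}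

/-- Convex functionals that are even and vanish at `0`; unlike in the usual definition of a convex
modular, `ρ x = 0` is allowed for `x ≠ 0`. -/
structure IsConvexModular (ρ : E → ℝ≥0∞) : Prop where
  map_zero : ρ 0 = 0
  map_neg (x : E) : ρ (-x) = ρ x
  convex (x y : E) (a b : ℝ≥0) : a + b = 1 → ρ (a • x + b • y) ≤ a * ρ x + b * ρ y

/-- The Luxemburg functional of a modular, with value `∞` at the points all of whose positive
multiples have modular larger than `1`. -/
noncomputable def luxemburg (ρ : E → ℝ≥0∞) (x : E) : ℝ≥0∞ :=
  ⨅ (r : ℝ≥0) (_ : 0 < r) (_ : ρ (r⁻¹ • x) ≤ 1), (r : ℝ≥0∞)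

/-- An upper bound for the growth of a modular along rays. -/
def HasPowerGrowth (ρ : E → ℝ≥0∞) (P : ℝ) : Prop :=
  ∀ (c : ℝ≥0) (x : E), 1 ≤ c → ρ (c • x) ≤ c ^ P * ρ x

theorem luxemburg_le {x : E} {r : ℝ≥0} (hr : 0 < r) (h : ρ (r⁻¹ • x) ≤ 1) : luxemburg ρ x ≤ r :=
  iInf_le_of_le r (iInf₂_le hr h)

theorem luxemburg_smul_le {c : ℝ≥0} (hc : c ≠ 0) (x : E) :
    luxemburg ρ (c • x) ≤ c * luxemburg ρ x := by
  have hc0 : (c : ℝ≥0∞) ≠ 0 := ENNReal.coe_ne_zero.2 hc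
  simp only [luxemburg, ENNReal.mul_iInf_of_ne hc0 ENNReal.coe_ne_top, ← ENNReal.coe_mul]
  refine le_iInf fun r => le_iInf₂ fun hr h => luxemburg_le (mul_pos hc.pos hr) ?_
  rwa [smul_smul, mul_inv_rev, inv_mul_cancel_right₀ hc]

namespace IsConvexModular

theorem map_smul_le (hρ : IsConvexModular ρ) {c : ℝ≥0} (hc : c ≤ 1) (x : E) :
    ρ (c • x) ≤ c * ρ x := by
  simpa [hρ.map_zero] using hρ.convex x 0 c (1 - c) (add_tsub_cancel_of_le hc)

theorem le_one_of_luxemburg_lt (hρ : IsConvexModular ρ) {x : E} {r : ℝ≥0}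
    (h : luxemburg ρ x < r) : ρ (r⁻¹ • x) ≤ 1 := by
  simp only [luxemburg, iInf_lt_iff, ENNReal.coe_lt_coe] at h
  obtain ⟨s, hs, hsx, hsr⟩ := h
  have hc : r⁻¹ * s ≤ 1 := by
    rw [mul_comm, ← div_eq_mul_inv]
    exact div_le_one_of_le₀ hsr.le zero_le
  calc ρ (r⁻¹ • x) = ρ ((r⁻¹ * s) • s⁻¹ • x) := by rw [smul_smul, mul_inv_cancel_right₀ hs.ne']
    _ ≤ (r⁻¹ * s : ℝ≥0) * ρ (s⁻¹ • x) := hρ.map_smul_le hc _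
    _ ≤ 1 := mul_le_one' (by exact_mod_cast hc) hsx

theorem luxemburg_add_le (hρ : IsConvexModular ρ) (x y : E) :
    luxemburg ρ (x + y) ≤ luxemburg ρ x + luxemburg ρ y := by
  simp only [luxemburg, ENNReal.iInf_add, ENNReal.add_iInf, ← ENNReal.coe_add]
  refine le_iInf fun s => le_iInf₂ fun hs hy => le_iInf fun r => le_iInf₂ fun hr hx =>
    luxemburg_le (add_pos hr hs) ?_
  have hrs : r + s ≠ 0 := (add_pos hr hs).ne'
  have hsum : r / (r + s) + s / (r + s) = 1 := by rw [← add_div, div_self hrs]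
  calc ρ ((r + s)⁻¹ • (x + y))
      = ρ ((r / (r + s)) • r⁻¹ • x + (s / (r + s)) • s⁻¹ • y) := by
        rw [smul_smul, smul_smul, div_mul_eq_mul_div, div_mul_eq_mul_div, mul_inv_cancel₀ hr.ne',
          mul_inv_cancel₀ hs.ne', one_div, smul_add]
    _ ≤ (r / (r + s) : ℝ≥0) * ρ (r⁻¹ • x) + (s / (r + s) : ℝ≥0) * ρ (s⁻¹ • y) :=
        hρ.convex _ _ _ _ hsum
    _ ≤ (r / (r + s) : ℝ≥0) * 1 + (s / (r + s) : ℝ≥0) * 1 := by gcongr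
    _ = 1 := by rw [mul_one, mul_one, ← ENNReal.coe_add, hsum, ENNReal.coe_one]

theorem luxemburg_zero (hρ : IsConvexModular ρ) : luxemburg ρ 0 = 0 := by
  refine le_antisymm (ENNReal.le_of_forall_pos_le_add fun r hr _ => ?_) zero_le
  rw [zero_add]
  exact luxemburg_le hr (by simp [hρ.map_zero])

theorem isExtendedSeminorm_luxemburg (hρ : IsConvexModular ρ) :
    IsExtendedSeminorm (luxemburg ρ) where
  add_le := hρ.luxemburg_add_le
  map_neg x := by simp only [luxemburg, smul_neg, hρ.map_neg]
  map_smul c x := by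
    rcases eq_or_ne c 0 with rfl | hc
    · simp [hρ.luxemburg_zero]
    · refine le_antisymm (luxemburg_smul_le hc x) ?_
      calc c * luxemburg ρ x = c * luxemburg ρ (c⁻¹ • c • x) := by rw [inv_smul_smul₀ hc]
        _ ≤ c * ((c⁻¹ : ℝ≥0) * luxemburg ρ (c • x)) := by
          gcongr
          exact luxemburg_smul_le (inv_ne_zero hc) _
        _ = luxemburg ρ (c • x) := by
          rw [← mul_assoc, ← ENNReal.coe_mul, mul_inv_cancel₀ hc, ENNReal.coe_one, one_mul]

theorem luxemburg_ne_top (hρ : IsConvexModular ρ) {x : E} (hx : ρ x ≠ ∞) :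
    luxemburg ρ x ≠ ∞ := by
  lift ρ x to ℝ≥0 using hx with m hm
  have hr : 1 ≤ max 1 m := le_max_left 1 m
  refine ne_top_of_le_ne_top ENNReal.coe_ne_top (luxemburg_le (zero_lt_one.trans_le hr) ?_)
  calc ρ ((max 1 m)⁻¹ • x) ≤ ((max 1 m)⁻¹ : ℝ≥0) * ρ x :=
        hρ.map_smul_le (inv_le_one_of_one_le₀ hr) x
    _ ≤ 1 := by
      rw [← hm, ← ENNReal.coe_mul, ENNReal.coe_le_one_iff, inv_mul_le_one₀ (by positivity)]
      exact le_max_right 1 m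

theorem eq_zero_of_luxemburg_eq_zero (hρ : IsConvexModular ρ) {x : E} (hx : luxemburg ρ x = 0) :
    ρ x = 0 := by
  refine le_antisymm (ENNReal.le_of_forall_pos_le_add fun r hr _ => ?_) zero_le
  have hs : 0 < min r 1 := lt_min hr one_pos
  have hle : ρ ((min r 1)⁻¹ • x) ≤ 1 := hρ.le_one_of_luxemburg_lt (by rw [hx]; exact_mod_cast hs)
  calc ρ x = ρ (min r 1 • (min r 1)⁻¹ • x) := by rw [smul_inv_smul₀ hs.ne']
    _ ≤ (min r 1 : ℝ≥0) * ρ ((min r 1)⁻¹ • x) := hρ.map_smul_le (min_le_right r 1) _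
    _ ≤ r * 1 := by gcongr; exact min_le_left r 1
    _ = 0 + r := by rw [mul_one, zero_add]

end IsConvexModular

theorem luxemburg_eq_iSup {ι : Type*} {ρ : ι → E → ℝ≥0∞} {σ : (ι → E) → ℝ≥0∞}
    (hρ : ∀ i, IsConvexModular (ρ i)) (hσ : ∀ F, σ F ≤ 1 ↔ ∀ i, ρ i (F i) ≤ 1) (F : ι → E) :
    luxemburg σ F = ⨆ i, luxemburg (ρ i) (F i) := by
  refine le_antisymm (le_of_forall_gt_imp_ge_of_dense fun s hs => ?_) (iSup_le fun i =>
    le_iInf fun r => le_iInf₂ fun hr h => luxemburg_le hr ((hσ _).1 h i))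
  rcases eq_or_ne s ∞ with rfl | hs_top
  · exact le_top
  lift s to ℝ≥0 using hs_top
  exact luxemburg_le (ENNReal.coe_pos.1 (zero_le.trans_lt hs)) <| (hσ _).2 fun i =>
    (hρ i).le_one_of_luxemburg_lt ((le_iSup (fun i => luxemburg (ρ i) (F i)) i).trans_lt hs)

theorem IsExtendedSeminorm.luxemburg_eq (hN : IsExtendedSeminorm ρ) (x : E) :
    luxemburg ρ x = ρ x := by
  refine le_antisymm (le_of_forall_gt_imp_ge_of_dense fun s hs => ?_)
    (le_iInf fun r => le_iInf₂ fun hr h => ?_)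
  · rcases eq_or_ne s ∞ with rfl | hs_top
    · exact le_top
    lift s to ℝ≥0 using hs_top
    have hs0 : 0 < s := ENNReal.coe_pos.1 (zero_le.trans_lt hs)
    refine luxemburg_le hs0 ?_
    rw [hN.map_smul, ENNReal.coe_inv hs0.ne', ← ENNReal.div_eq_inv_mul]
    exact ENNReal.div_le_of_le_mul (by simpa using hs.le)
  · rw [hN.map_smul, ENNReal.coe_inv hr.ne', ← ENNReal.div_eq_inv_mul,
      ENNReal.div_le_iff (ENNReal.coe_ne_zero.2 hr.ne') ENNReal.coe_ne_top, one_mul] at h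
    exact h

namespace HasPowerGrowth

theorem luxemburg_le_of_le {P : ℝ} (hgrowth : HasPowerGrowth ρ P) (hP : 0 ≤ P) {k : ℝ≥0}
    (hk0 : 0 < k) (hk1 : k ≤ 1) {x : E} (hx : ρ x ≤ k ^ P) : luxemburg ρ x ≤ k := by
  refine luxemburg_le hk0 ((hgrowth _ x (one_le_inv_iff₀.2 ⟨hk0, hk1⟩)).trans ?_)
  calc (k⁻¹ : ℝ≥0) ^ P * ρ x ≤ (k⁻¹ : ℝ≥0) ^ P * k ^ P := by gcongr
    _ = 1 := by
      rw [← ENNReal.mul_rpow_of_nonneg _ _ hP, ← ENNReal.coe_mul, inv_mul_cancel₀ hk0.ne',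
        ENNReal.coe_one, ENNReal.one_rpow]

theorem le_one_of_luxemburg_le_one {P : ℝ} (hgrowth : HasPowerGrowth ρ P) (hP : 0 < P)
    (hρ : IsConvexModular ρ) {x : E} (hx : luxemburg ρ x ≤ 1) : ρ x ≤ 1 := by
  refine le_of_forall_gt_imp_ge_of_dense fun s hs => ?_
  rcases eq_or_ne s ∞ with rfl | hs_top
  · exact le_top
  lift s to ℝ≥0 using hs_top
  have hr : 1 < s ^ P⁻¹ := NNReal.one_lt_rpow (by exact_mod_cast hs) (inv_pos.2 hP)
  have hr0 : s ^ P⁻¹ ≠ 0 := (zero_lt_one.trans hr).ne'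
  have hle := hρ.le_one_of_luxemburg_lt (hx.trans_lt (ENNReal.coe_lt_coe.2 hr))
  calc ρ x = ρ (s ^ P⁻¹ • (s ^ P⁻¹)⁻¹ • x) := by rw [smul_inv_smul₀ hr0]
    _ ≤ (s ^ P⁻¹ : ℝ≥0) ^ P * ρ ((s ^ P⁻¹)⁻¹ • x) := hgrowth _ _ hr.le
    _ ≤ (s ^ P⁻¹ : ℝ≥0) ^ P * 1 := by gcongr
    _ = s := by
      rw [mul_one, ← ENNReal.coe_rpow_of_nonneg _ hP.le, NNReal.rpow_inv_rpow hP.ne']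

end HasPowerGrowth

end Luxemburg

section ConvexityGap

variable {E : Type*} [AddCommGroup E] [Module ℝ≥0 E] {ρ N : E → ℝ≥0∞}

/-- If `ρ x` and `ρ y` exceed `2 * ρ ((x + y) / 2)` only slightly on average, then `ρ (x - y)` is
small: it is at most `C` times the convexity gap of `ρ` at `x, y`, up to an error
`ε * (ρ x + ρ y)`. All terms are moved to the side where they are added, since `ρ` may be
infinite. -/
def HasConvexityGap (ρ : E → ℝ≥0∞) (ε C : ℝ≥0) : Prop :=
  ∀ x y, ρ (x - y) + C * ρ ((2⁻¹ : ℝ≥0) • (x + y)) ≤ (ε + C / 2 : ℝ≥0) * (ρ x + ρ y)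

theorem HasConvexityGap.mono_left {ε ε' C : ℝ≥0} (h : HasConvexityGap ρ ε C) (hε : ε ≤ ε') :
    HasConvexityGap ρ ε' C := fun x y => (h x y).trans (by gcongr)

theorem IsUniformlyConvex.exists_hasConvexityGap_rpow (huc : IsUniformlyConvex N)
    (hN : IsExtendedSeminorm N) {p₁ : ℝ} (p₂ : ℝ) (hp₁ : 1 < p₁) {ε : ℝ≥0} (hε : 0 < ε) :
    ∃ C : ℝ≥0, 0 < C ∧ ∀ p ∈ Set.Icc p₁ p₂, HasConvexityGap (fun x => N x ^ p) ε C := by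
  obtain ⟨t, ht, hmid⟩ := huc.exists_midpoint_le hN (lt_min hε one_pos)
  obtain ⟨C, hC, hscalar⟩ := exists_rpow_add_mul_rpow_le p₂ hp₁ (min_le_right ε 1) ht
  refine ⟨C, hC, fun p hp => .mono_left (fun x y => ?_) (min_le_left ε 1)⟩
  have hp0 : 0 < p := by linarith [hp.1]
  have hmidle := hN.midpoint_le x y
  have hsuble := hN.sub_le x y
  wlog hyx : N y ≤ N x generalizing x y
  · have h := this y x (hN.midpoint_le y x) (hN.sub_le y x) (le_of_not_ge hyx)
    rwa [hN.map_sub_comm, add_comm y, add_comm (N y ^ p)] at h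
  rcases eq_or_ne (N x) ∞ with hx | hx
  · simp [hx, hp0, hε.ne']
  have hy : N y ≠ ∞ := ne_top_of_le_ne_top hx hyx
  have hm : N ((2⁻¹ : ℝ≥0) • (x + y)) ≠ ∞ :=
    ne_top_of_le_ne_top (ENNReal.div_ne_top (ENNReal.add_ne_top.2 ⟨hx, hy⟩) two_ne_zero) hmidle
  have hd : N (x - y) ≠ ∞ := ne_top_of_le_ne_top (ENNReal.add_ne_top.2 ⟨hx, hy⟩) hsuble
  have himp := hmid (N x).toNNReal x y
  lift N x to ℝ≥0 using hx with a
  lift N y to ℝ≥0 using hy with b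
  lift N (x - y) to ℝ≥0 using hd with d
  lift N ((2⁻¹ : ℝ≥0) • (x + y)) to ℝ≥0 using hm with m
  simp only [← ENNReal.coe_rpow_of_nonneg _ hp0.le]
  norm_cast at hyx hmidle hsuble himp ⊢
  exact hscalar p hp a b m d hyx hmidle hsuble fun h => himp le_rfl hyx h

theorem isUniformlyConvex_of_hasConvexityGap
    (hgap : ∀ ε : ℝ≥0, 0 < ε → ∃ C : ℝ≥0, 0 < C ∧ HasConvexityGap ρ ε C) :
    IsUniformlyConvex ρ := by
  intro ε hε
  obtain ⟨C, hC, hgap⟩ := hgap (ε / 4) (by positivity)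
  have hC0 : C ≠ 0 := hC.ne'
  refine ⟨1 - ε / (2 * C), tsub_lt_self one_pos (by positivity), fun x y hx hy hxy => ?_⟩
  have h : ε + C * ρ ((2⁻¹ : ℝ≥0) • (x + y)) ≤ (ε / 4 + C / 2 : ℝ≥0) * (1 + 1) := calc
    _ ≤ _ := by gcongr
    _ ≤ _ := hgap x y
    _ ≤ _ := by gcongr
  have hm : ρ ((2⁻¹ : ℝ≥0) • (x + y)) ≠ ∞ := by
    rintro hm
    rw [hm, ENNReal.mul_top (ENNReal.coe_ne_zero.2 hC0), add_top, top_le_iff] at h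
    exact ENNReal.mul_ne_top ENNReal.coe_ne_top (by norm_num) h
  lift ρ ((2⁻¹ : ℝ≥0) • (x + y)) to ℝ≥0 using hm with m
  norm_cast at h ⊢
  refine le_tsub_of_add_le_right ?_
  have h2 : 2 * C * m + ε ≤ 2 * C := by
    rw [← NNReal.coe_le_coe] at h ⊢
    push_cast at h ⊢
    linarith
  calc m + ε / (2 * C) = (2 * C * m + ε) / (2 * C) := by field_simp
    _ ≤ 1 := div_le_one_of_le₀ h2 zero_le

theorem IsUniformlyConvex.luxemburg (huc : IsUniformlyConvex ρ) (hρ : IsConvexModular ρ) {P : ℝ}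
    (hgrowth : HasPowerGrowth ρ P) (hP : 0 < P) : IsUniformlyConvex (luxemburg ρ) := by
  intro ε hε
  have hk0 : 0 < min ε 1 / 2 := by positivity
  have hkε : min ε 1 / 2 < ε := (half_lt_self (by positivity)).trans_le (min_le_left ε 1)
  have hk1 : min ε 1 / 2 ≤ 1 := (half_le_self zero_le).trans (min_le_right ε 1)
  obtain ⟨t, ht, hmid⟩ := huc ((min ε 1 / 2) ^ P) (NNReal.rpow_pos hk0)
  have hs0 : 0 < max t 2⁻¹ := lt_max_of_lt_right (by positivity)
  have hs1 : max t 2⁻¹ < 1 := max_lt ht (by norm_num)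
  refine ⟨max t 2⁻¹ ^ P⁻¹, NNReal.rpow_lt_one hs1 (inv_pos.2 hP), fun x y hx hy hxy => ?_⟩
  refine hgrowth.luxemburg_le_of_le hP.le (NNReal.rpow_pos hs0)
    (NNReal.rpow_le_one hs1.le (inv_nonneg.2 hP.le)) ?_
  have hdist : ((min ε 1 / 2) ^ P : ℝ≥0) ≤ ρ (x - y) := by
    by_contra! hlt
    rw [ENNReal.coe_rpow_of_nonneg _ hP.le] at hlt
    have := hxy.trans (hgrowth.luxemburg_le_of_le hP.le hk0 hk1 hlt.le)
    exact hkε.not_ge (by exact_mod_cast this)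
  calc ρ ((2⁻¹ : ℝ≥0) • (x + y))
      ≤ t := hmid x y (hgrowth.le_one_of_luxemburg_le_one hP hρ hx)
        (hgrowth.le_one_of_luxemburg_le_one hP hρ hy) hdist
    _ ≤ (max t 2⁻¹ : ℝ≥0) := by gcongr; exact le_max_left t _
    _ = _ := by rw [← ENNReal.coe_rpow_of_nonneg _ hP.le, NNReal.rpow_inv_rpow hP.ne']

end ConvexityGap

section SumsAndIntegrals

variable {E ι α : Type*} [AddCommGroup E] [Module ℝ≥0 E] [MeasurableSpace α] {μ : Measure α}

theorem IsExtendedSeminorm.tsum {N : ι → E → ℝ≥0∞} (hN : ∀ i, IsExtendedSeminorm (N i)) :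
    IsExtendedSeminorm (fun F : ι → E => ∑' i, N i (F i)) where
  add_le F G := by
    rw [← ENNReal.tsum_add]
    exact ENNReal.tsum_le_tsum fun i => (hN i).add_le (F i) (G i)
  map_neg F := by simp only [Pi.neg_apply, (hN _).map_neg]
  map_smul c F := by simp only [Pi.smul_apply, (hN _).map_smul, ENNReal.tsum_mul_left]

theorem IsExtendedSeminorm.hasPowerGrowth_rpow {N : E → ℝ≥0∞} (hN : IsExtendedSeminorm N)
    {p P : ℝ} (hp : 0 ≤ p) (hpP : p ≤ P) : HasPowerGrowth (fun x => N x ^ p) P := by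
  intro c x hc
  simp only [hN.map_smul, ENNReal.mul_rpow_of_nonneg _ _ hp]
  gcongr
  exact_mod_cast hc

theorem HasPowerGrowth.tsum {ρ : ι → E → ℝ≥0∞} {P : ℝ} (h : ∀ i, HasPowerGrowth (ρ i) P) :
    HasPowerGrowth (fun F : ι → E => ∑' i, ρ i (F i)) P := fun c F hc => by
  rw [← ENNReal.tsum_mul_left]
  exact ENNReal.tsum_le_tsum fun i => h i c (F i) hc

theorem HasConvexityGap.tsum {ρ : ι → E → ℝ≥0∞} {ε C : ℝ≥0}
    (h : ∀ i, HasConvexityGap (ρ i) ε C) :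
    HasConvexityGap (fun F : ι → E => ∑' i, ρ i (F i)) ε C := fun F G => by
  simp only [← ENNReal.tsum_mul_left, ← ENNReal.tsum_add]
  exact ENNReal.tsum_le_tsum fun i => h i (F i) (G i)

variable [TopologicalSpace E] [IsTopologicalAddGroup E] [ContinuousConstSMul ℝ≥0 E]

theorem HasPowerGrowth.lintegral {ρ : α → E → ℝ≥0∞} {P : ℝ} (hP : 0 ≤ P)
    (h : ∀ᵐ x ∂μ, HasPowerGrowth (ρ x) P) :
    HasPowerGrowth (fun F : α →ₘ[μ] E => ∫⁻ x, ρ x (F x) ∂μ) P := fun c F hc => by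
  rw [← lintegral_const_mul' _ _ (ENNReal.rpow_ne_top_of_nonneg hP ENNReal.coe_ne_top)]
  refine lintegral_mono_ae ?_
  filter_upwards [h, AEEqFun.coeFn_smul c F] with x hx hF
  rw [hF]
  exact hx c (F x) hc

theorem HasConvexityGap.lintegral {ρ : α → E → ℝ≥0∞} {ε C : ℝ≥0}
    (hρ : ∀ F : α →ₘ[μ] E, AEMeasurable (fun x => ρ x (F x)) μ)
    (h : ∀ᵐ x ∂μ, HasConvexityGap (ρ x) ε C) :
    HasConvexityGap (fun F : α →ₘ[μ] E => ∫⁻ x, ρ x (F x) ∂μ) ε C := fun F G => by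
  rw [← lintegral_add_left' (hρ F), ← lintegral_const_mul' _ _ ENNReal.coe_ne_top,
    ← lintegral_const_mul' _ _ ENNReal.coe_ne_top]
  refine (le_lintegral_add _ _).trans (lintegral_mono_ae ?_)
  filter_upwards [h, AEEqFun.coeFn_sub F G, AEEqFun.coeFn_add F G,
    AEEqFun.coeFn_smul (2⁻¹ : ℝ≥0) (F + G)] with x hx hsub hadd hmid
  rw [hsub, hmid, Pi.smul_apply, hadd]
  exact hx (F x) (G x)

end SumsAndIntegrals

section ModularsOnClasses

variable {𝕜 : Type*} [RCLike 𝕜] {n : ℕ}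

/-- The modular of `L^{p(·)}` on classes modulo equality almost everywhere, which unlike functions
into `𝕜` form the space on which the convexity of the modular holds without measurability
assumptions. -/
noncomputable def aeVarModular (p : EuclideanSpace ℝ (Fin n) → ℝ≥0∞)
    (F : EuclideanSpace ℝ (Fin n) →ₘ[volume] 𝕜) : ℝ≥0∞ :=
  varModular p F

/-- The modular of `ℓ^q(L^{p(·)})` for constant `q`, on sequences of classes modulo equality almost
everywhere. -/
noncomputable def aeMixedModular (p : EuclideanSpace ℝ (Fin n) → ℝ≥0∞) (q : ℝ≥0∞)
    (F : ℕ → EuclideanSpace ℝ (Fin n) →ₘ[volume] 𝕜) : ℝ≥0∞ :=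
  mixedModular p (fun _ => q) fun ν => F ν

theorem aeVarModular_smul (p : EuclideanSpace ℝ (Fin n) → ℝ≥0∞) (c : ℝ≥0)
    (F : EuclideanSpace ℝ (Fin n) →ₘ[volume] 𝕜) :
    aeVarModular p (c • F) = varModular p fun x => (c : ℝ) • F x := by
  refine varModular_congr_norm ?_
  filter_upwards [AEEqFun.coeFn_smul c F] with x hx
  rw [hx, Pi.smul_apply, NNReal.smul_def]

theorem aeMixedModular_smul (p : EuclideanSpace ℝ (Fin n) → ℝ≥0∞) (q : ℝ≥0∞) (c : ℝ≥0)
    (F : ℕ → EuclideanSpace ℝ (Fin n) →ₘ[volume] 𝕜) :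
    aeMixedModular p q (c • F) = mixedModular p (fun _ => q) fun ν x => (c : ℝ) • F ν x := by
  refine mixedModular_congr_norm fun ν => ?_
  filter_upwards [AEEqFun.coeFn_smul c (F ν)] with x hx
  rw [Pi.smul_apply, hx, Pi.smul_apply, NNReal.smul_def]

theorem isConvexModular_aeVarModular (p : VariableExponent n) :
    IsConvexModular (aeVarModular (𝕜 := 𝕜) p.toFun) where
  map_zero := by
    refine (varModular_congr_norm ?_).trans (varModular_zero (𝕜 := 𝕜) p)
    filter_upwards [AEEqFun.coeFn_zero (μ := volume) (β := 𝕜)] with x hx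
    rw [hx, Pi.zero_apply]
  map_neg F := by
    refine varModular_congr_norm ?_
    filter_upwards [AEEqFun.coeFn_neg F] with x hx
    rw [hx, Pi.neg_apply, norm_neg]
  convex F G a b hab := by
    have hadd : aeVarModular p.toFun (a • F + b • G) =
        varModular p.toFun fun x => (a : ℝ) • F x + (b : ℝ) • G x := by
      refine varModular_congr_norm ?_
      filter_upwards [AEEqFun.coeFn_add (a • F) (b • G), AEEqFun.coeFn_smul a F,
        AEEqFun.coeFn_smul b G] with x hx hF hG
      rw [hx, Pi.add_apply, hF, hG]
      rfl
    have hconvex := varModular_convex p (g := G) F.aestronglyMeasurable a.2 b.2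
      (by exact_mod_cast hab.le)
    simp only [NNReal.val_eq_coe, ENNReal.ofReal_coe_nnreal] at hconvex
    exact hadd.trans_le hconvex

theorem isConvexModular_aeMixedModular (p : VariableExponent n) {q : ℝ≥0∞} (hq : 1 ≤ q) :
    IsConvexModular (aeMixedModular (𝕜 := 𝕜) p.toFun q) where
  map_zero := by
    refine (mixedModular_congr_norm fun ν => ?_).trans
      (mixedModular_zero (𝕜 := 𝕜) p fun _ => q)
    filter_upwards [AEEqFun.coeFn_zero (μ := volume) (β := 𝕜)] with x hx
    rw [Pi.zero_apply, hx, Pi.zero_apply]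
  map_neg F := by
    refine mixedModular_congr_norm fun ν => ?_
    filter_upwards [AEEqFun.coeFn_neg (F ν)] with x hx
    rw [Pi.neg_apply, hx, Pi.neg_apply, norm_neg]
  convex F G a b hab := by
    rcases eq_zero_or_pos a with rfl | ha
    · obtain rfl : b = 1 := by simpa using hab
      rw [zero_smul ℝ≥0 F, zero_add, one_smul]
      simp
    rcases eq_zero_or_pos b with rfl | hb
    · obtain rfl : a = 1 := by simpa using hab
      rw [zero_smul ℝ≥0 G, add_zero, one_smul]
      simp
    have hadd : aeMixedModular p.toFun q (a • F + b • G) =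
        mixedModular p.toFun (fun _ => q) fun ν x => (a : ℝ) • F ν x + (b : ℝ) • G ν x := by
      refine mixedModular_congr_norm fun ν => ?_
      filter_upwards [AEEqFun.coeFn_add (a • F ν) (b • G ν), AEEqFun.coeFn_smul a (F ν),
        AEEqFun.coeFn_smul b (G ν)] with x hx hF hG
      rw [Pi.add_apply, Pi.smul_apply, Pi.smul_apply, hx, Pi.add_apply, hF, hG]
      rfl
    have hconvex := mixedModular_convex p q hq (fun ν => (F ν).aestronglyMeasurable)
      (g := fun ν => G ν) (NNReal.coe_pos.2 ha) (NNReal.coe_pos.2 hb) (by exact_mod_cast hab)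
    simp only [ENNReal.ofReal_coe_nnreal] at hconvex
    exact hadd.trans_le hconvex

theorem aeMixedModular_eq_tsum (p : EuclideanSpace ℝ (Fin n) → ℝ≥0∞) {q : ℝ≥0∞} (hq : 1 ≤ q)
    (hq_top : q ≠ ∞) (F : ℕ → EuclideanSpace ℝ (Fin n) →ₘ[volume] 𝕜) :
    aeMixedModular p q F = ∑' ν, luxemburg (aeVarModular p) (F ν) ^ q.toReal := by
  have hq0 : 0 < q.toReal := ENNReal.toReal_pos (by positivity) hq_top
  refine tsum_congr fun ν => ?_
  have hpow : luxemburg (aeVarModular p) (F ν) ^ q.toReal =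
      ⨅ (r : ℝ≥0) (_ : 0 < r) (_ : aeVarModular p (r⁻¹ • F ν) ≤ 1), (r : ℝ≥0∞) ^ q.toReal := by
    simp only [luxemburg, ← ENNReal.orderIsoRpow_apply q.toReal hq0, OrderIso.map_iInf]
  simp only [hpow, aeVarModular_smul, ENNReal.toReal_inv]
  refine le_antisymm (le_iInf fun r => le_iInf₂ fun hr hF => ?_)
    (le_iInf fun t => le_iInf₂ fun ht hF => ?_)
  · refine iInf_le_of_le ((r ^ q.toReal : ℝ≥0) : ℝ) (iInf₂_le_of_le ?_ ?_ ?_)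
    · exact NNReal.coe_pos.2 (NNReal.rpow_pos hr)
    · rwa [← NNReal.coe_rpow, NNReal.rpow_rpow_inv hq0.ne', ← NNReal.coe_inv]
    · rw [ENNReal.ofReal_coe_nnreal, ENNReal.coe_rpow_of_nonneg _ hq0.le]
  · lift t to ℝ≥0 using ht.le
    refine iInf_le_of_le (t ^ q.toReal⁻¹) (iInf₂_le_of_le (NNReal.rpow_pos ht) ?_ ?_)
    · rwa [NNReal.coe_inv, NNReal.coe_rpow]
    · rw [← ENNReal.coe_rpow_of_nonneg _ hq0.le, NNReal.rpow_inv_rpow hq0.ne',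
        ENNReal.ofReal_coe_nnreal]

theorem aeMixedModular_top_le_one_iff (p : EuclideanSpace ℝ (Fin n) → ℝ≥0∞)
    (F : ℕ → EuclideanSpace ℝ (Fin n) →ₘ[volume] 𝕜) :
    aeMixedModular p ∞ F ≤ 1 ↔ ∀ ν, aeVarModular p (F ν) ≤ 1 := by
  simp only [aeMixedModular, mixedModular, ENNReal.inv_top, ENNReal.toReal_zero, Real.rpow_zero,
    inv_one, one_smul]
  refine ⟨fun h ν => ?_, fun h => ?_⟩
  · by_contra hν
    have hterm := (ENNReal.le_tsum ν).trans h
    simp only [aeVarModular] at hν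
    simp [hν] at hterm
  · refine (ENNReal.tsum_eq_zero.2 fun ν => ?_).trans_le zero_le
    refine le_antisymm (ENNReal.le_of_forall_pos_le_add fun ε hε _ => ?_) zero_le
    refine iInf_le_of_le (ε : ℝ) (iInf₂_le_of_le (NNReal.coe_pos.2 hε) (h ν) ?_)
    rw [ENNReal.ofReal_coe_nnreal, zero_add]

end ModularsOnClasses

section UniformConvexity

variable {𝕜 : Type*} [RCLike 𝕜] {n : ℕ}

theorem VariableExponent.exists_bounds (p : VariableExponent n) (h₁ : 1 < p.lower)
    (h₂ : p.upper < ∞) :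
    ∃ p₁ p₂ : ℝ, 1 < p₁ ∧ p₁ ≤ p₂ ∧
      ∀ᵐ x, p.toFun x ≠ ∞ ∧ (p.toFun x).toReal ∈ Set.Icc p₁ p₂ := by
  have hlower : ∀ᵐ x, p.lower ≤ p.toFun x := ae_essInf_le
  have hupper : ∀ᵐ x, p.toFun x ≤ p.upper := ENNReal.ae_le_essSup p.toFun
  obtain ⟨x, hx₁, hx₂⟩ := (hlower.and hupper).exists
  have hle : p.lower ≤ p.upper := hx₁.trans hx₂
  refine ⟨p.lower.toReal, p.upper.toReal, ?_, ENNReal.toReal_mono h₂.ne hle, ?_⟩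
  · rwa [← ENNReal.toReal_one, ENNReal.toReal_lt_toReal ENNReal.one_ne_top (hle.trans_lt h₂).ne]
  · filter_upwards [hlower, hupper] with x hx₁ hx₂
    have hx : p.toFun x ≠ ∞ := (hx₂.trans_lt h₂).ne
    exact ⟨hx, ENNReal.toReal_mono hx hx₁, ENNReal.toReal_mono h₂.ne hx₂⟩

theorem varModular_eq_lintegral {p : EuclideanSpace ℝ (Fin n) → ℝ≥0∞} (hp : ∀ᵐ x, p x ≠ ∞)
    (f : EuclideanSpace ℝ (Fin n) → 𝕜) :
    varModular p f = ∫⁻ x, ‖f x‖ₑ ^ (p x).toReal := by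
  have htop : volume.restrict {x | p x = ∞} = 0 := by
    rw [Measure.restrict_eq_zero]
    simpa only [ae_iff, not_not] using hp
  have hfin : volume.restrict {x | p x ≠ ∞} = volume := Measure.restrict_eq_self_of_ae_mem hp
  rw [varModular, htop, hfin, eLpNormEssSup_measure_zero, add_zero]

theorem isUniformlyConvex_luxemburg_aeVarModular (p : VariableExponent n) (h₁ : 1 < p.lower)
    (h₂ : p.upper < ∞) : IsUniformlyConvex (luxemburg (aeVarModular (𝕜 := 𝕜) p.toFun)) := by
  obtain ⟨p₁, p₂, hp₁, hp₁₂, hp⟩ := p.exists_bounds h₁ h₂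
  have hp₂ : 0 < p₂ := by linarith
  have hmodular : aeVarModular (𝕜 := 𝕜) p.toFun =
      fun F => ∫⁻ x, ‖F x‖ₑ ^ (p.toFun x).toReal :=
    funext fun F => varModular_eq_lintegral (hp.mono fun x hx => hx.1) F
  have hgrowth : HasPowerGrowth (aeVarModular (𝕜 := 𝕜) p.toFun) p₂ := by
    rw [hmodular]
    exact .lintegral hp₂.le <| hp.mono fun x hx =>
      isExtendedSeminorm_enorm.hasPowerGrowth_rpow ENNReal.toReal_nonneg hx.2.2
  refine IsUniformlyConvex.luxemburg (isUniformlyConvex_of_hasConvexityGap fun ε hε => ?_)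
    (isConvexModular_aeVarModular p) hgrowth hp₂
  obtain ⟨C, hC, hgap⟩ := (isUniformlyConvex_enorm 𝕜).exists_hasConvexityGap_rpow
    isExtendedSeminorm_enorm p₂ hp₁ hε
  refine ⟨C, hC, ?_⟩
  rw [hmodular]
  exact .lintegral (fun F => F.aestronglyMeasurable.enorm.pow
    p.measurable_toFun.ennreal_toReal.aemeasurable) (hp.mono fun x hx => hgap _ hx.2)

theorem isUniformlyConvex_luxemburg_aeMixedModular (p : VariableExponent n) {q : ℝ≥0∞}
    (hq : 1 < q) (hq_top : q < ∞) (h₁ : 1 < p.lower) (h₂ : p.upper < ∞) :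
    IsUniformlyConvex (luxemburg (aeMixedModular (𝕜 := 𝕜) p.toFun q)) := by
  have hq' : 1 < q.toReal := by
    rwa [← ENNReal.toReal_one, ENNReal.toReal_lt_toReal ENNReal.one_ne_top hq_top.ne]
  have hN : IsExtendedSeminorm (luxemburg (aeVarModular (𝕜 := 𝕜) p.toFun)) :=
    (isConvexModular_aeVarModular p).isExtendedSeminorm_luxemburg
  have hmodular : aeMixedModular (𝕜 := 𝕜) p.toFun q =
      fun F => ∑' ν, luxemburg (aeVarModular p.toFun) (F ν) ^ q.toReal :=
    funext (aeMixedModular_eq_tsum p.toFun hq.le hq_top.ne)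
  have hgrowth : HasPowerGrowth (aeMixedModular (𝕜 := 𝕜) p.toFun q) q.toReal := by
    rw [hmodular]
    exact .tsum fun _ => hN.hasPowerGrowth_rpow ENNReal.toReal_nonneg le_rfl
  refine IsUniformlyConvex.luxemburg (isUniformlyConvex_of_hasConvexityGap fun ε hε => ?_)
    (isConvexModular_aeMixedModular p hq.le) hgrowth (zero_lt_one.trans hq')
  obtain ⟨C, hC, hgap⟩ := (isUniformlyConvex_luxemburg_aeVarModular p h₁
    h₂).exists_hasConvexityGap_rpow hN q.toReal hq' hε
  refine ⟨C, hC, ?_⟩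
  rw [hmodular]
  exact .tsum fun _ => hgap _ ⟨le_rfl, le_rfl⟩

theorem memMixed_of_luxemburg_ne_top {p : EuclideanSpace ℝ (Fin n) → ℝ≥0∞} {q : ℝ≥0∞}
    {F : ℕ → EuclideanSpace ℝ (Fin n) →ₘ[volume] 𝕜}
    (hF : luxemburg (aeMixedModular p q) F ≠ ∞) : MemMixed p (fun _ => q) fun ν => F ν := by
  simp only [luxemburg, aeMixedModular_smul, ← lt_top_iff_ne_top, iInf_lt_iff] at hF
  obtain ⟨r, hr, hle, -⟩ := hF
  exact ⟨r, NNReal.coe_pos.2 hr, hle.trans_lt ENNReal.one_lt_top⟩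

theorem enorm_eq_luxemburg {p : VariableExponent n} {q : ℝ≥0∞} [hq : Fact (1 ≤ q)]
    (f : MixedSpace 𝕜 p q) : ‖f‖ₑ = luxemburg (aeMixedModular p.toFun q) f.1 := by
  obtain ⟨r₀, hr₀⟩ := MemMixed.exists_le_one hq.out (fun ν => (f.1 ν).aestronglyMeasurable) f.2
  rw [← ofReal_norm]
  simp only [luxemburg, aeMixedModular_smul, NNReal.coe_inv]
  refine le_antisymm (le_iInf fun r => le_iInf₂ fun hr hf => ?_)
    (le_of_forall_gt_imp_ge_of_dense fun s hs => ?_)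
  · rw [← ENNReal.ofReal_coe_nnreal]
    exact ENNReal.ofReal_le_ofReal (csInf_le ⟨0, fun _ ht => ht.1.le⟩ ⟨NNReal.coe_pos.2 hr, hf⟩)
  · rcases eq_or_ne s ∞ with rfl | hs_top
    · exact le_top
    lift s to ℝ≥0 using hs_top
    rw [← ENNReal.ofReal_coe_nnreal, ENNReal.ofReal_lt_ofReal_iff_of_nonneg (norm_nonneg f)] at hs
    obtain ⟨r, ⟨hr, hf⟩, hrs⟩ := exists_lt_of_csInf_lt ⟨r₀, hr₀⟩ hs
    lift r to ℝ≥0 using hr.le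
    exact iInf_le_of_le r (iInf₂_le_of_le (NNReal.coe_pos.1 hr) hf (by exact_mod_cast hrs.le))

theorem uniformConvexSpace_mixedSpace (p : VariableExponent n) {q : ℝ≥0∞} [Fact (1 ≤ q)]
    (hq : 1 < q) (hq_top : q < ∞) (h₁ : 1 < p.lower) (h₂ : p.upper < ∞) :
    UniformConvexSpace (MixedSpace 𝕜 p q) :=
  (isConvexModular_aeMixedModular (𝕜 := 𝕜) p hq.le).isExtendedSeminorm_luxemburg.uniformConvexSpace
    (isUniformlyConvex_luxemburg_aeMixedModular p hq hq_top h₁ h₂)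
    (mixedSubmodule 𝕜 p q).subtype.toAddMonoidHom enorm_eq_luxemburg

end UniformConvexity

section PairSequences

variable {E : Type*}

/-- The sequence `(x, y, 0, 0, …)`; such sequences embed the `ℓ^q`-sum of two copies of a seminormed
space into the `ℓ^q`-sum of countably many. -/
def pairSeq [Zero E] (x y : E) : ℕ → E
  | 0 => x
  | 1 => y
  | _ + 2 => 0

theorem pairSeq_add [AddZeroClass E] (x y x' y' : E) :
    pairSeq x y + pairSeq x' y' = pairSeq (x + x') (y + y') := by
  ext (_ | _ | i) <;> simp [pairSeq]

theorem pairSeq_sub [SubNegZeroMonoid E] (x y x' y' : E) :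
    pairSeq x y - pairSeq x' y' = pairSeq (x - x') (y - y') := by
  ext (_ | _ | i) <;> simp [pairSeq]

theorem tsum_pairSeq [Zero E] {N : E → ℝ≥0∞} (hN : N 0 = 0) (x y : E) :
    ∑' i, N (pairSeq x y i) = N x + N y := by
  rw [tsum_eq_sum (s := Finset.range 2), Finset.sum_range_succ, Finset.sum_range_one]
  · rfl
  · rintro (_ | _ | i) hi
    · simp at hi
    · simp at hi
    · exact hN

theorem iSup_pairSeq [Zero E] {N : E → ℝ≥0∞} (hN : N 0 = 0) (x y : E) :
    ⨆ i, N (pairSeq x y i) = max (N x) (N y) := by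
  refine le_antisymm (iSup_le ?_) (max_le (le_iSup (fun i => N (pairSeq x y i)) 0)
    (le_iSup (fun i => N (pairSeq x y i)) 1))
  rintro (_ | _ | _)
  · exact le_max_left _ _
  · exact le_max_right _ _
  · exact hN.trans_le zero_le

end PairSequences

section Counterexamples

theorem not_uniformConvexSpace_of_norm_add_sub {X : Type*} [SeminormedAddCommGroup X] {x y : X}
    (hx : ‖x‖ = 1) (hy : ‖y‖ = 1) (hadd : ‖x + y‖ = 2) (hsub : ‖x - y‖ = 2) :
    ¬ UniformConvexSpace X := fun _ => by
  obtain ⟨δ, hδ, hconvex⟩ := exists_forall_sphere_dist_add_le_two_sub X two_pos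
  linarith [hconvex hx hy hsub.ge]

variable {𝕜 : Type*} [RCLike 𝕜] {n : ℕ} (p : VariableExponent n)

theorem varModular_indicator_ne_top {s : Set (EuclideanSpace ℝ (Fin n))} (hs : volume s ≠ ∞) :
    varModular p.toFun (s.indicator fun _ => (1 : 𝕜)) ≠ ∞ := by
  have hm : MeasurableSet {x | p.toFun x ≠ ∞} :=
    p.measurable_toFun (measurableSet_singleton ∞).compl
  have hpow : ∀ᵐ x ∂volume.restrict {x | p.toFun x ≠ ∞},
      ‖s.indicator (fun _ => (1 : 𝕜)) x‖ₑ ^ (p.toFun x).toReal ≤ s.indicator 1 x := by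
    filter_upwards [ae_restrict_of_ae p.one_le, ae_restrict_mem hm] with x hx hx_top
    have hp : 0 < (p.toFun x).toReal := ENNReal.toReal_pos (zero_lt_one.trans_le hx).ne' hx_top
    by_cases hxs : x ∈ s <;> simp [hxs, hp]
  have hint : ∫⁻ x in {x | p.toFun x ≠ ∞},
      ‖s.indicator (fun _ => (1 : 𝕜)) x‖ₑ ^ (p.toFun x).toReal ≤ volume s := calc
    _ ≤ ∫⁻ x in {x | p.toFun x ≠ ∞}, s.indicator 1 x := lintegral_mono_ae hpow
    _ ≤ ∫⁻ x, s.indicator 1 x := setLIntegral_le_lintegral _ _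
    _ ≤ volume s := lintegral_indicator_one_le s
  exact ENNReal.add_ne_top.2 ⟨ne_top_of_le_ne_top hs hint,
    ne_top_of_le_ne_top enorm_ne_top (eLpNormEssSup_indicator_const_le s (1 : 𝕜))⟩

theorem exists_luxemburg_aeVarModular_eq_one :
    ∃ F : EuclideanSpace ℝ (Fin n) →ₘ[volume] 𝕜, luxemburg (aeVarModular p.toFun) F = 1 := by
  let B : Set (EuclideanSpace ℝ (Fin n)) := Metric.ball 0 1
  let φ : EuclideanSpace ℝ (Fin n) → 𝕜 := B.indicator fun _ => 1
  have hφ : AEStronglyMeasurable φ :=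
    (stronglyMeasurable_const.indicator measurableSet_ball).aestronglyMeasurable
  have hmodular : aeVarModular p.toFun (AEEqFun.mk φ hφ) = varModular p.toFun φ :=
    varModular_congr_norm ((AEEqFun.coeFn_mk φ hφ).mono fun x hx => congrArg norm hx)
  have hne_zero : varModular p.toFun φ ≠ 0 := fun h => by
    have hvol : volume B = 0 := measure_mono_null (fun x hx => by simp [φ, hx])
      (ae_iff.1 (ae_eq_zero_of_varModular p hφ h))
    exact (Metric.measure_ball_pos volume 0 one_pos).ne' hvol
  have hne_top : varModular p.toFun φ ≠ ∞ :=
    varModular_indicator_ne_top p measure_ball_lt_top.ne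
  have hρ := isConvexModular_aeVarModular (𝕜 := 𝕜) p
  obtain ⟨c, hc⟩ := hρ.isExtendedSeminorm_luxemburg.exists_smul_eq_one
    (fun h => hne_zero (hmodular.symm.trans (hρ.eq_zero_of_luxemburg_eq_zero h)))
    (hρ.luxemburg_ne_top (hmodular.trans_ne hne_top))
  exact ⟨_, hc⟩

theorem luxemburg_aeMixedModular_one (F : ℕ → EuclideanSpace ℝ (Fin n) →ₘ[volume] 𝕜) :
    luxemburg (aeMixedModular p.toFun 1) F = ∑' ν, luxemburg (aeVarModular p.toFun) (F ν) := by
  have hmodular : aeMixedModular (𝕜 := 𝕜) p.toFun 1 =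
      fun F => ∑' ν, luxemburg (aeVarModular p.toFun) (F ν) := funext fun F => by
    simp only [aeMixedModular_eq_tsum p.toFun le_rfl ENNReal.one_ne_top F, ENNReal.toReal_one,
      ENNReal.rpow_one]
  rw [hmodular]
  exact (IsExtendedSeminorm.tsum fun _ =>
    (isConvexModular_aeVarModular p).isExtendedSeminorm_luxemburg).luxemburg_eq F

theorem luxemburg_aeMixedModular_top (F : ℕ → EuclideanSpace ℝ (Fin n) →ₘ[volume] 𝕜) :
    luxemburg (aeMixedModular p.toFun ∞) F = ⨆ ν, luxemburg (aeVarModular p.toFun) (F ν) :=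
  luxemburg_eq_iSup (fun _ => isConvexModular_aeVarModular p)
    (aeMixedModular_top_le_one_iff p.toFun) F

variable {p}

theorem not_uniformConvexSpace_mixedSpace {q : ℝ≥0∞} [Fact (1 ≤ q)]
    {F G : ℕ → EuclideanSpace ℝ (Fin n) →ₘ[volume] 𝕜}
    (hF : luxemburg (aeMixedModular p.toFun q) F = 1)
    (hG : luxemburg (aeMixedModular p.toFun q) G = 1)
    (hadd : luxemburg (aeMixedModular p.toFun q) (F + G) = 2)
    (hsub : luxemburg (aeMixedModular p.toFun q) (F - G) = 2) :
    ¬ UniformConvexSpace (MixedSpace 𝕜 p q) := by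
  let f : MixedSpace 𝕜 p q :=
    ⟨F, memMixed_of_luxemburg_ne_top (hF.trans_ne ENNReal.one_ne_top)⟩
  let g : MixedSpace 𝕜 p q :=
    ⟨G, memMixed_of_luxemburg_ne_top (hG.trans_ne ENNReal.one_ne_top)⟩
  have hnorm (h : MixedSpace 𝕜 p q) :
      ‖h‖ = (luxemburg (aeMixedModular p.toFun q) h.1).toReal := by
    rw [← enorm_eq_luxemburg, toReal_enorm]
  refine not_uniformConvexSpace_of_norm_add_sub (x := f) (y := g) ?_ ?_ ?_ ?_
  · rw [hnorm, hF, ENNReal.toReal_one]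
  · rw [hnorm, hG, ENNReal.toReal_one]
  · exact (hnorm _).trans (congrArg ENNReal.toReal hadd)
  · exact (hnorm _).trans (congrArg ENNReal.toReal hsub)

variable (𝕜 p)

theorem not_uniformConvexSpace_mixedSpace_one : ¬ UniformConvexSpace (MixedSpace 𝕜 p 1) := by
  have hN := (isConvexModular_aeVarModular (𝕜 := 𝕜) p).isExtendedSeminorm_luxemburg
  obtain ⟨F, hF⟩ := exists_luxemburg_aeVarModular_eq_one (𝕜 := 𝕜) p
  refine not_uniformConvexSpace_mixedSpace (F := pairSeq F 0) (G := pairSeq 0 F) ?_ ?_ ?_ ?_ <;>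
  simp only [pairSeq_add, pairSeq_sub, luxemburg_aeMixedModular_one, tsum_pairSeq hN.map_zero,
    add_zero, zero_add, sub_zero, zero_sub, hN.map_neg, hN.map_zero, hF, one_add_one_eq_two]

theorem not_uniformConvexSpace_mixedSpace_top : ¬ UniformConvexSpace (MixedSpace 𝕜 p ∞) := by
  have hN := (isConvexModular_aeVarModular (𝕜 := 𝕜) p).isExtendedSeminorm_luxemburg
  obtain ⟨F, hF⟩ := exists_luxemburg_aeVarModular_eq_one (𝕜 := 𝕜) p
  have htwo : luxemburg (aeVarModular p.toFun) (F + F) = 2 := by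
    rw [← two_smul ℝ≥0 F, hN.map_smul, hF, mul_one, ENNReal.coe_ofNat]
  refine not_uniformConvexSpace_mixedSpace (F := pairSeq F F) (G := pairSeq F (-F)) ?_ ?_ ?_ ?_ <;>
  simp only [pairSeq_add, pairSeq_sub, luxemburg_aeMixedModular_top, iSup_pairSeq hN.map_zero,
    add_neg_cancel, sub_self, sub_neg_eq_add, hN.map_neg, hN.map_zero, hF, htwo, max_self,
    max_eq_left zero_le, max_eq_right zero_le]

end Counterexamples

theorem mainTheorem4 {𝕜 : Type*} [RCLike 𝕜] {n : ℕ} (p : VariableExponent n) :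
    (∀ (q : ℝ≥0∞) [Fact (1 ≤ q)], 1 < q → q < ∞ → 1 < p.lower → p.upper < ∞ →
      UniformConvexSpace (MixedSpace 𝕜 p q)) ∧
    ¬ UniformConvexSpace (MixedSpace 𝕜 p ∞) ∧
    ¬ UniformConvexSpace (MixedSpace 𝕜 p 1) :=
  ⟨fun _ _ hq hq_top h₁ h₂ => uniformConvexSpace_mixedSpace p hq hq_top h₁ h₂,
    not_uniformConvexSpace_mixedSpace_top 𝕜 p, not_uniformConvexSpace_mixedSpace_one 𝕜 p⟩
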